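/- Let $L_1,L_2,L_3$ be three geodesics of the real hyperbolic plane $\mathbb{H}^2$, any two of which intersect, with $\angle(L_2,L_3)=\angle(L_1,L_3)=\pi/3$ and $\angle(L_1,L_2)=\pi/9$. Let $I_k$ be the inversion (reflection) in $L_k$, and let $\Delta_{3,3,9}=\langle I_1,I_2,I_3\rangle$. Let $A_1$ be the intersection point of $L_1$ and $L_3$, let $A_2$ be that of $L_2$ and $L_3$, and put $A_{2k+1}=(I_2I_1)^k(A_1)$ and $A_{2k+2}=(I_2I_1)^k(A_2)$ for $k$ modulo $9$; these are the vertices of a regular $18$-gon. Let $\Gamma$ be the subgroup of $\Delta_{3,3,9}$ generated by \begin{align*} s_I&=(I_2I_1)^2I_2I_3, & s_{II}&=(I_1I_2)^2s_I(I_2I_1)^2, & s_{III}&=I_2I_1s_I I_1I_2, \\ s_{IV}&=(I_1I_2)^4I_3I_2I_1I_2, & s_V&=(I_1I_2)^3s_{IV}(I_2I_1)^3, & s_{VI}&=(I_2I_1)^3s_I(I_1I_2)^3, \\ s_{VII}&=(I_2I_1)^4s_I(I_1I_2)^4, & s_{VIII}&=(I_2I_1)^3s_{IV}(I_1I_2)^3,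 & s_{IX}&=(I_1I_2)^3s_I(I_2I_1)^3. \end{align*} Then: 1. The isometries $s_I,\dots,s_{IX}$ map the sides $[A_jA_{j+1}]$ with $j=1,15,3,4,16,7,9,10,13$ onto the sides $[A_jA_{j+1}]$ with $j=6,2,8,11,5,12,14,17,18$, respectively (indices modulo $18$). The group $\Gamma$ has index $18$ in $\Delta_{3,3,9}$, and it is isomorphic to the fundamental group of the closed orientable surface of genus $2$, that is, to $\langle a_1,b_1,a_2,b_2\mid [a_1,b_1][a_2,b_2]\rangle$. 2. The isometry $f=I_1I_3I_2I_3$ is hyperbolic, with some translation length $\ell>0$, and some positive power of $f$ lies in $\Gamma$. Let $n$ be the least $n\geq 1$ with $f^n\in\Gamma$. The axis of $f$, parametrized by arc length, projects to a closed geodesic of period $n\ell$ in $\Sigma=\mathbb{H}^2/\Gamma$. This closed geodesic is non-simple: it has exactly $9$ self-intersection points, and it passes through each of them exactly twice in one period. -/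

import Mathlib

open scoped UpperHalfPlane

/-! ## Geodesics, angles and inversions in the hyperbolic plane

The hyperbolic plane is the upper half-plane `ℍ` with its hyperbolic distance, and its isometry
group is `ℍ ≃ᵢ ℍ`, whose product is composition: `(f * g) z = f (g z)`. -/

/-- `L` and `L'` are two geodesics of the hyperbolic plane which meet at angle `θ`.
Geodesics are parametrized by arc length, as isometric embeddings of the real line. The upper
half-plane is a conformal model, so angles are Euclidean angles between velocity vectors. -/
def MeetAtAngle (L L' : Set ℍ) (θ : ℝ) : Prop :=
  ∃ γ δ : ℝ → ℍ, Isometry γ ∧ Isometry δ ∧ Set.range γ = L ∧ Set.range δ = L' ∧ γ 0 = δ 0 ∧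
    InnerProductGeometry.angle (deriv (fun t => (γ t : ℂ)) 0) (deriv (fun t => (δ t : ℂ)) 0) = θ

/-- `I` is the inversion in the geodesic `L`: the isometry whose set of fixed points is `L`. -/
def IsInversionIn (I : ℍ ≃ᵢ ℍ) (L : Set ℍ) : Prop :=
  {z : ℍ | I z = z} = L

/-- The geodesic segment with endpoints `z` and `w`. -/
def geodesicSegment (z w : ℍ) : Set ℍ :=
  {x | dist z x + dist x w = dist z w}

/-- The isometry `f` is hyperbolic with translation length `ℓ > 0`, and `γ` is an arc length
parametrization of its axis, oriented by `f`: on it, `f` is the translation by `ℓ`.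
(For given `f`, the number `ℓ` is unique and `γ` is unique up to a shift of the parameter.) -/
structure IsAxis (f : ℍ ≃ᵢ ℍ) (γ : ℝ → ℍ) (ℓ : ℝ) : Prop where
  isometry : Isometry γ
  length_pos : 0 < ℓ
  translate : ∀ t : ℝ, f (γ t) = γ (t + ℓ)

/-! ## Quotients of the hyperbolic plane -/

/-- Isometries act on the hyperbolic plane by evaluation. -/
noncomputable instance isometryAction : MulAction (ℍ ≃ᵢ ℍ) ℍ where
  smul f z := f z
  one_smul _ := rfl
  mul_smul _ _ _ := rfl

/-- The quotient of the hyperbolic plane by a group `Γ` of isometries. -/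
abbrev HypQuotient (Γ : Subgroup (ℍ ≃ᵢ ℍ)) : Type :=
  MulAction.orbitRel.Quotient Γ ℍ

/-- The projection to the quotient of the hyperbolic plane by `Γ` of a curve `γ`. -/
noncomputable def projectedCurve (Γ : Subgroup (ℍ ≃ᵢ ℍ)) (γ : ℝ → ℍ) : ℝ → HypQuotient Γ :=
  fun t => Quotient.mk (MulAction.orbitRel Γ ℍ) (γ t)

/-! ## Closed curves, as periodic maps on the real line -/

/-- The closed curve `c`, of period `T`, is simple: it does not self-intersect. -/
def IsSimpleClosedCurve {X : Type} (c : ℝ → X) (T : ℝ) : Prop :=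
  Set.InjOn c (Set.Ico 0 T)

/-- The set of times, in one period, at which the closed curve `c` of period `T` is at `x`. -/
def passages {X : Type} (c : ℝ → X) (T : ℝ) (x : X) : Set ℝ :=
  {t | t ∈ Set.Ico 0 T ∧ c t = x}

/-- The points at which the closed curve `c`, of period `T`, intersects itself. -/
def selfIntersectionPoints {X : Type} (c : ℝ → X) (T : ℝ) : Set X :=
  {x | ∃ s ∈ passages c T x, ∃ t ∈ passages c T x, s ≠ t}

/-! ## Surface groups -/

/-- The product of commutators `[a₁, b₁] ⋯ [a_g, b_g]`, where `a_i` is the generator `(i, false)`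
and `b_i` is the generator `(i, true)`. -/
def surfaceRelator (g : ℕ) : FreeGroup (Fin g × Bool) :=
  (List.ofFn fun i : Fin g =>
    FreeGroup.of (i, false) * FreeGroup.of (i, true) *
      (FreeGroup.of (i, false))⁻¹ * (FreeGroup.of (i, true))⁻¹).prod

/-- The fundamental group of the closed orientable surface of genus `g ≥ 1`. -/
abbrev SurfaceGroup (g : ℕ) : Type :=
  PresentedGroup {surfaceRelator g}

/-! ## The triangle group, the polygon and the side pairings -/

section TriangleGroup

variable (I₁ I₂ I₃ : ℍ ≃ᵢ ℍ)

/-- The group generated by the inversions in the three sides of a triangle. -/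
noncomputable def triangleGroup : Subgroup (ℍ ≃ᵢ ℍ) :=
  Subgroup.closure {I₁, I₂, I₃}

/-- The vertices of the polygon `A₁A₂…A₁₈`, built from `A₁` and `A₂`:
`A_{2k+1} = (I₂I₁)^k A₁` and `A_{2k+2} = (I₂I₁)^k A₂`. -/
noncomputable def polygonVertex (A₁ A₂ : ℍ) (j : ℤ) : ℍ :=
  if Odd j then ((I₂ * I₁) ^ ((j - 1) / 2)) A₁ else ((I₂ * I₁) ^ ((j - 2) / 2)) A₂

/-- The side `[A_j A_{j+1}]` of the polygon `A₁A₂…A₁₈`. -/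
noncomputable def polygonSide (A₁ A₂ : ℍ) (j : ℤ) : Set ℍ :=
  geodesicSegment (polygonVertex I₁ I₂ A₁ A₂ j) (polygonVertex I₁ I₂ A₁ A₂ (j + 1))

/-- The side pairing `s_I`. -/
noncomputable def sI : ℍ ≃ᵢ ℍ := (I₂ * I₁) ^ 2 * I₂ * I₃

/-- The side pairing `s_IV`. -/
noncomputable def sIV : ℍ ≃ᵢ ℍ := (I₁ * I₂) ^ 4 * I₃ * I₂ * I₁ * I₂

/-- The nine side pairings `s_I, …, s_IX`, in this order. -/
noncomputable def sidePairing : Fin 9 → (ℍ ≃ᵢ ℍ) :=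
  ![sI I₁ I₂ I₃,
    (I₁ * I₂) ^ 2 * sI I₁ I₂ I₃ * (I₂ * I₁) ^ 2,
    (I₂ * I₁) * sI I₁ I₂ I₃ * (I₁ * I₂),
    sIV I₁ I₂ I₃,
    (I₁ * I₂) ^ 3 * sIV I₁ I₂ I₃ * (I₂ * I₁) ^ 3,
    (I₂ * I₁) ^ 3 * sI I₁ I₂ I₃ * (I₁ * I₂) ^ 3,
    (I₂ * I₁) ^ 4 * sI I₁ I₂ I₃ * (I₁ * I₂) ^ 4,
    (I₂ * I₁) ^ 3 * sIV I₁ I₂ I₃ * (I₁ * I₂) ^ 3,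
    (I₁ * I₂) ^ 3 * sI I₁ I₂ I₃ * (I₂ * I₁) ^ 3]

/-- The index `j` of the side `[A_j A_{j+1}]` from which each side pairing starts. -/
def sourceSide : Fin 9 → ℤ := ![1, 15, 3, 4, 16, 7, 9, 10, 13]

/-- The index `j` of the side `[A_j A_{j+1}]` onto which each side pairing maps its source. -/
def targetSide : Fin 9 → ℤ := ![6, 2, 8, 11, 5, 12, 14, 17, 18]

/-- The group `Γ` generated by the side pairings. -/
noncomputable def surfaceSubgroup : Subgroup (ℍ ≃ᵢ ℍ) :=
  Subgroup.closure (Set.range (sidePairing I₁ I₂ I₃))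

end TriangleGroup

/-! Everything is reduced to the abstract Coxeter group `W` of type (3,3,9). In the hyperboloid
model, let `h i` be the Lorentz product of a point with the inward unit normal of the `i`-th side of
the triangle `T`. Under the reflections these functions transform like coordinates dual to simple
roots. Tits' length argument (`IsRootFunctions.nonneg_of_length_lt`) then shows that an element
moving a point of the closed chamber into the closed chamber is trivial if the point is interior,
and is trivial or the reflection in the wall if the point is interior to a wall. In particular `W`
acts faithfully.

The group `Γ` is studied through the action of `W` on the 18 triangles of the polygon, where the
third reflection leaves through a side and re-enters through the paired one. Since the Schreier
generators of the stabilizer of the first triangle are trivial or side pairings, `Γ` is this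
stabilizer (`mem_surfaceSubgroup339_iff`) and has index 18. For the presentation, the same action is
given labels in a group `S`: crossing a side multiplies by an element of `S`. The Coxeter relations
hold as soon as the labels satisfy the six vertex relations (`isLiftable_pairingPerm`). Five of
these eliminate generators and the sixth becomes `[a₁, b₁][a₂, b₂]`. Taking for `S` the genus 2
surface group, the label recovers an element of `S` from its image in `W`, so the map from the
surface group to `W` is injective.

As for `f`, it is the product of the reflections in `L₁` and `I₃L₂`. These lines are at distance `2e
> 0`, so `f` translates by `4e` along their common perpendicular `η`. Between the two lines, `η`
crosses `T` from `L₁` to the midpoint of its base, and then crosses `I₃T`. Folding the second half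
back by `I₃` and using the chamber property gives `IsFoldedAxis.rigid`. As `Γ` preserves
orientation, two points of the axis are identified by an element of `Γ` other than a power of `f`
only if both are base midpoints (`IsFoldedAxis.even_crossing`). The first power of `f` in `Γ` is the
ninth, a period contains 18 midpoints, and a finite table groups them in nine pairs. -/

/-! ## Chambers of Coxeter group actions -/

namespace CoxeterSystem

variable {B W X : Type*} [Group W] [MulAction W X] {M : CoxeterMatrix B}

/-- The functions `h i` on a `W`-set transform like the coordinates `⟪·, αᵢ⟫` of the dual of the
geometric representation, where `αᵢ` are the simple roots. -/
def IsRootFunctions (cs : CoxeterSystem M W) (h : B → X → ℝ) : Prop :=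
  ∀ i j x, h i (cs.simple j • x) = h i x + 2 * Real.cos (Real.pi / M i j) * h j x

variable {cs : CoxeterSystem M W} {h : B → X → ℝ}

theorem IsRootFunctions.simple_self (H : cs.IsRootFunctions h) (i : B) (x : X) :
    h i (cs.simple i • x) = -h i x := by
  rw [H i i x]; simp; ring

/-- In the dihedral group of `s` and `t`, the transformed coordinate satisfies the Chebyshev
recursion of `sin (kθ)` with `θ = π / M s t`. The parity of `k` decides which of `s`, `t` is the
first letter of the word. -/
theorem IsRootFunctions.sin_mul_alternatingWord (H : cs.IsRootFunctions h) (x : X) (k : ℕ)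
    (s t : B) :
    Real.sin (Real.pi / M s t) * h s ((cs.wordProd (alternatingWord s t k))⁻¹ • x) =
      if Even k then
        Real.sin ((k + 1) * (Real.pi / M s t)) * h s x + Real.sin (k * (Real.pi / M s t)) * h t x
      else
        Real.sin ((k + 1) * (Real.pi / M s t)) * h t x +
          Real.sin (k * (Real.pi / M s t)) * h s x := by
  induction k using Nat.strong_induction_on generalizing s t with
  | _ k ih =>
    match k with
    | 0 => simp [alternatingWord]
    | 1 =>
      have h2 : Real.sin ((1 + 1) * (Real.pi / M s t)) =
          2 * Real.sin (Real.pi / M s t) * Real.cos (Real.pi / M s t) := by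
        rw [← Real.sin_two_mul]; norm_num
      simp [alternatingWord, H s t x, h2]
      ring
    | k + 2 =>
      have e1 := ih (k + 1) (by omega) t s
      have e0 := ih k (by omega) s t
      have hw : (cs.wordProd (alternatingWord s t (k + 2)))⁻¹ • x =
          cs.simple t • (cs.wordProd (alternatingWord t s (k + 1)))⁻¹ • x := by
        rw [alternatingWord_succ, wordProd_concat, mul_inv_rev, mul_smul, inv_simple]
      have hw' : (cs.wordProd (alternatingWord t s (k + 1)))⁻¹ • x =
          cs.simple s • (cs.wordProd (alternatingWord s t k))⁻¹ • x := by
        rw [alternatingWord_succ, wordProd_concat, mul_inv_rev, mul_smul, inv_simple]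
      rw [hw, H s t]
      have hs : h s ((cs.wordProd (alternatingWord t s (k + 1)))⁻¹ • x) =
          -h s ((cs.wordProd (alternatingWord s t k))⁻¹ • x) := by
        rw [hw', H.simple_self]
      rw [hs]
      rw [M.symmetric t s] at e1
      set θ := Real.pi / M s t
      have a3 : Real.sin (((k + 2 : ℕ) + 1) * θ) =
          2 * Real.cos θ * Real.sin (((k + 1 : ℕ) + 1) * θ) - Real.sin ((k + 1) * θ) := by
        have := Real.sin_add_sin (((k + 2 : ℕ) + 1) * θ) ((k + 1) * θ)
        have e : ((((k + 2 : ℕ) : ℝ) + 1) * θ + (k + 1) * θ) / 2 = ((k + 1 : ℕ) + 1) * θ := by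
          push_cast; ring
        have e' : ((((k + 2 : ℕ) : ℝ) + 1) * θ - (k + 1) * θ) / 2 = θ := by push_cast; ring
        rw [e, e'] at this
        linarith
      have a2 : Real.sin ((k + 2 : ℕ) * θ) =
          2 * Real.cos θ * Real.sin ((k + 1 : ℕ) * θ) - Real.sin (k * θ) := by
        have := Real.sin_add_sin ((k + 2 : ℕ) * θ) (k * θ)
        have e : (((k + 2 : ℕ) : ℝ) * θ + k * θ) / 2 = (k + 1 : ℕ) * θ := by push_cast; ring
        have e' : (((k + 2 : ℕ) : ℝ) * θ - k * θ) / 2 = θ := by push_cast; ring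
        rw [e, e'] at this
        linarith
      rw [a3, a2]
      by_cases hk : Even k
      · have h1 : ¬ Even (k + 1) := by simpa [Nat.even_add_one] using hk
        have h2 : Even (k + 2) := by simpa [Nat.even_add_one] using hk
        rw [if_neg h1] at e1
        rw [if_pos hk] at e0
        rw [if_pos h2]
        linear_combination 2 * Real.cos θ * e1 - e0
      · have h1 : Even (k + 1) := by simpa [Nat.even_add_one] using hk
        have h2 : ¬ Even (k + 2) := by simpa [Nat.even_add_one] using hk
        rw [if_pos h1] at e1
        rw [if_neg hk] at e0
        rw [if_neg h2]
        linear_combination 2 * Real.cos θ * e1 - e0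

/-- For `k < M s t` the angles `kθ` and `(k+1)θ` lie in `[0, π]`, so both coefficients in the
preceding formula are nonnegative. The word ends in `t`: this is the rank two case of the length
criterion below. -/
theorem IsRootFunctions.alternatingWord_nonneg (H : cs.IsRootFunctions h) {x : X} {k : ℕ}
    {s t : B} (hst : s ≠ t) (hk : k < M s t) (hs : 0 ≤ h s x) (ht : 0 ≤ h t x) :
    0 ≤ h s ((cs.wordProd (alternatingWord s t k))⁻¹ • x) := by
  have hm2 : 2 ≤ M s t := by have := M.off_diagonal s t hst; omega
  have hm : (2 : ℝ) ≤ M s t := by exact_mod_cast hm2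
  have hθ : 0 < Real.pi / M s t := by positivity
  have hsin : 0 < Real.sin (Real.pi / M s t) := by
    apply Real.sin_pos_of_pos_of_lt_pi hθ
    rw [div_lt_iff₀ (by linarith)]
    nlinarith [Real.pi_pos]
  have key : ∀ j : ℕ, j ≤ M s t → 0 ≤ Real.sin (j * (Real.pi / M s t)) := by
    intro j hj
    apply Real.sin_nonneg_of_nonneg_of_le_pi (by positivity)
    have : (j : ℝ) ≤ M s t := by exact_mod_cast hj
    calc (j : ℝ) * (Real.pi / M s t) ≤ M s t * (Real.pi / M s t) := by gcongr
      _ = Real.pi := by field_simp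
  have k0 := key k hk.le
  have k1 := key (k + 1) hk
  push_cast at k1
  have := H.sin_mul_alternatingWord x k s t
  refine nonneg_of_mul_nonneg_right (a := Real.sin (Real.pi / M s t)) ?_ hsin
  rw [this]
  split_ifs <;> positivity

/-- A right multiplication which increases the length corresponds to a positive root. -/
theorem IsRootFunctions.nonneg_of_length_lt (H : cs.IsRootFunctions h) (hM : ∀ i j, M i j ≠ 0)
    {x : X} (hx : ∀ i, 0 ≤ h i x) (w : W) (s : B)
    (hs : cs.length w < cs.length (w * cs.simple s)) : 0 ≤ h s (w⁻¹ • x) := by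
  induction hn : cs.length w using Nat.strong_induction_on generalizing w s with
  | _ n ih =>
    subst hn
    rcases eq_or_ne w 1 with rfl | hw1
    · simpa using hx s
    obtain ⟨t, ht⟩ := cs.exists_rightDescent_of_ne_one hw1
    have ht' := (cs.isRightDescent_iff).1 ht
    have hst : s ≠ t := by
      rintro rfl
      omega
    -- Split off from `w` a right factor in the dihedral group of `s` and `t`, with additive lengths
    -- and with `v` as short as possible. Then neither `s` nor `t` is a right descent of `v`, and
    -- induction applies to `v`.
    let Q : ℕ → Prop := fun n => ∃ (v : W) (k : ℕ) (a b : B), ((a = s ∧ b = t) ∨ (a = t ∧ b = s)) ∧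
      w = v * cs.wordProd (alternatingWord a b k) ∧ cs.length w = cs.length v + k ∧
      cs.length v = n
    have hQ0 : Q (cs.length (w * cs.simple t)) :=
      ⟨w * cs.simple t, 1, s, t, Or.inl ⟨rfl, rfl⟩, by simp [alternatingWord], by omega, rfl⟩
    have hQ : ∃ n, Q n := ⟨_, hQ0⟩
    classical
    obtain ⟨v, k, a, b, hab, hwv, hl, hv⟩ := Nat.find_spec hQ
    have hlt : cs.length v < cs.length w := by
      have := Nat.find_min' hQ hQ0
      omega
    have hup : ∀ c, c = s ∨ c = t → cs.length v < cs.length (v * cs.simple c) := by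
      intro c hc
      rcases cs.length_mul_simple v c with h1 | h1
      · omega
      exfalso
      have hlow : ∀ u : W, w = v * cs.simple c * u → k < cs.length u + 1 := by
        intro u hu
        have := cs.length_mul_le (v * cs.simple c) u
        rw [← hu] at this
        omega
      have hmin : ¬ Q (cs.length (v * cs.simple c)) := Nat.find_min hQ (by omega)
      have hcons : w = v * cs.simple c * (cs.simple c * cs.wordProd (alternatingWord a b k)) := by
        rw [hwv]; simp [mul_assoc]
      cases k with
      | zero =>
        rcases hc with rfl | rfl
        · exact hmin ⟨v * cs.simple c, 1, t, c, Or.inr ⟨rfl, rfl⟩,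
            by rw [hwv]; simp [alternatingWord], by omega, rfl⟩
        · exact hmin ⟨v * cs.simple c, 1, s, c, Or.inl ⟨rfl, rfl⟩,
            by rw [hwv]; simp [alternatingWord], by omega, rfl⟩
      | succ k =>
        -- Either `c` prolongs the alternating word on the left, which gives a shorter `v`, or it
        -- cancels its first letter, which makes `w` too short.
        by_cases hce : c = if Even (k + 1) then b else a
        · refine hmin ⟨v * cs.simple c, k + 2, a, b, hab, ?_, by omega, rfl⟩
          rw [alternatingWord_succ', ← hce, wordProd_cons, ← hcons]
        · have hce' : (if Even k then b else a) = c := by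
            simp only [Nat.even_add_one] at hce
            rcases hab with ⟨rfl, rfl⟩ | ⟨rfl, rfl⟩ <;> rcases hc with rfl | rfl <;>
              split_ifs at hce ⊢ <;> simp_all
          rw [alternatingWord_succ', hce', wordProd_cons] at hcons
          have := hlow _ hcons
          simp only [simple_mul_simple_cancel_left] at this
          have h2 := cs.length_wordProd_le (alternatingWord a b k)
          rw [length_alternatingWord] at h2
          have h3 := hlow (cs.wordProd (alternatingWord a b k)) (by rw [hcons]; simp)
          omega
    have zs : 0 ≤ h s (v⁻¹ • x) := ih _ hlt v s (hup s (Or.inl rfl)) rfl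
    have zt : 0 ≤ h t (v⁻¹ • x) := by
      exact ih _ hlt v t (hup t (Or.inr rfl)) rfl
    -- The alternating word cannot end in `s`, as otherwise `w * s` would be shorter than `w`.
    have hnots : ∀ c j, w ≠ v * cs.wordProd (alternatingWord c s (j + 1)) ∨ j + 1 ≠ k := by
      intro c j
      by_contra! hc
      have h1 : w * cs.simple s = v * cs.wordProd (alternatingWord s c j) := by
        rw [hc.1, alternatingWord_succ, wordProd_concat]; simp [mul_assoc]
      have h2 := cs.length_mul_le v (cs.wordProd (alternatingWord s c j))
      have h3 := cs.length_wordProd_le (alternatingWord s c j)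
      rw [length_alternatingWord] at h3
      rw [← h1] at h2
      omega
    have hw2 : w = v * cs.wordProd (alternatingWord s t k) := by
      rcases hab with ⟨rfl, rfl⟩ | ⟨rfl, rfl⟩
      · exact hwv
      · cases k with
        | zero => rw [hwv]; simp [alternatingWord]
        | succ k => rcases hnots a k with h1 | h1 <;> [exact absurd hwv h1; exact absurd rfl h1]
    have hk : k < M s t := by
      by_contra! hk
      rcases hk.eq_or_lt with hk | hk
      -- At `k = M s t` the braid relation rewrites the word so that it ends in `s`. Beyond that
      -- length an alternating word is not reduced.
      · obtain ⟨j, hj⟩ := Nat.exists_eq_succ_of_ne_zero (hM s t)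
        have hb := cs.wordProd_braidWord_eq s t
        rw [braidWord, braidWord, ← M.symmetric s t, hk] at hb
        rw [hb] at hw2
        have hkj : k = j + 1 := by omega
        subst hkj
        rcases hnots t j with h1 | h1 <;> [exact absurd hw2 h1; exact absurd rfl h1]
      · have h1 := cs.not_isReduced_alternatingWord s t (hM s t) hk
        have h2 := cs.length_wordProd_le (alternatingWord s t k)
        have h3 := cs.length_mul_le v (cs.wordProd (alternatingWord s t k))
        rw [← hw2] at h3
        rw [IsReduced, length_alternatingWord] at h1
        rw [length_alternatingWord] at h2
        omega
    rw [hw2, mul_inv_rev, mul_smul]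
    exact H.alternatingWord_nonneg hst hk zs zt

/-- For a right descent `i` of `w`, put `u = w sᵢ`. The length criterion for `u` at the point `w •
x` says that `h i (sᵢ • x) = -h i x` is nonnegative. The hypothesis on `M` excludes infinite orders,
which a Coxeter matrix encodes by `0`. -/
theorem IsRootFunctions.exists_eq_zero (H : cs.IsRootFunctions h) (hM : ∀ i j, M i j ≠ 0)
    {x : X} {w : W} (hx : ∀ i, 0 ≤ h i x) (hwx : ∀ i, 0 ≤ h i (w • x)) (hw : w ≠ 1) :
    ∃ i, h i x = 0 ∧ cs.length (w * cs.simple i) < cs.length w := by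
  obtain ⟨i, hi⟩ := cs.exists_rightDescent_of_ne_one hw
  refine ⟨i, le_antisymm ?_ (hx i), hi⟩
  have h1 : cs.length (w * cs.simple i) < cs.length (w * cs.simple i * cs.simple i) := by
    rwa [simple_mul_simple_cancel_right]
  have := H.nonneg_of_length_lt hM hwx _ i h1
  rw [mul_inv_rev, inv_simple, mul_smul, inv_smul_smul, H.simple_self] at this
  linarith

/-- A point of the open chamber is moved out of the closed chamber by all group elements. -/
theorem IsRootFunctions.eq_one (H : cs.IsRootFunctions h) (hM : ∀ i j, M i j ≠ 0)
    {x : X} {w : W} (hx : ∀ i, 0 < h i x) (hwx : ∀ i, 0 ≤ h i (w • x)) : w = 1 := by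
  by_contra hw
  obtain ⟨i, hi, -⟩ := H.exists_eq_zero hM (fun i => (hx i).le) hwx hw
  exact (hx i).ne' hi

/-- A point in the relative interior of a wall of the chamber is moved out of the closed chamber by
all group elements but the reflection in this wall. -/
theorem IsRootFunctions.eq_one_or_eq_simple (H : cs.IsRootFunctions h) (hM : ∀ i j, M i j ≠ 0)
    {x : X} {w : W} (i : B) (hi : h i x = 0) (hx : ∀ j, j ≠ i → 0 < h j x)
    (hwx : ∀ i, 0 ≤ h i (w • x)) : w = 1 ∨ w = cs.simple i := by
  have hx' : ∀ j, 0 ≤ h j x := by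
    intro j
    rcases eq_or_ne j i with rfl | hj
    · exact hi.ge
    · exact (hx j hj).le
  by_contra! hw
  obtain ⟨j, hj, hl⟩ := H.exists_eq_zero hM hx' hwx hw.1
  obtain rfl : j = i := by
    by_contra hji
    exact (hx j hji).ne' hj
  have hsx : ∀ k, h k (cs.simple j • x) = h k x := by
    intro k
    rw [H, hj]; ring
  -- Since `sⱼ` fixes all coordinates of `x`, the argument can be repeated for `w sⱼ`. It would
  -- again have the descent `j`, which is absurd.
  have hw' : w * cs.simple j ≠ 1 := fun h1 => hw.2 (by
    rw [← cs.inv_simple]; exact eq_inv_of_mul_eq_one_left h1)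
  obtain ⟨k, hk, hl'⟩ := H.exists_eq_zero (x := cs.simple j • x) (w := w * cs.simple j) hM
    (by simpa only [hsx] using hx') (by simpa [smul_smul] using hwx) hw'
  obtain rfl : k = j := by
    by_contra hkj
    rw [hsx] at hk
    exact (hx k hkj).ne' hk
  rw [simple_mul_simple_cancel_right] at hl'
  omega

end CoxeterSystem

/-! ## Words in the dihedral group of the polygon -/

section Polygon

variable {G : Type*} [Group G]

/-- The element which takes the triangle with base `[A₁A₂]` to the one with base `[A_j A_{j+1}]`. -/
def polygonElement (I₁ I₂ : G) (j : ℤ) : G :=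
  if Odd j then (I₂ * I₁) ^ ((j - 1) / 2) else (I₂ * I₁) ^ ((j - 2) / 2) * I₂

theorem polygonElement_odd (I₁ I₂ : G) (k : ℤ) :
    polygonElement I₁ I₂ (2 * k + 1) = (I₂ * I₁) ^ k := by
  have h : Odd (2 * k + 1) := ⟨k, rfl⟩
  have e : (2 * k + 1 - 1) / 2 = k := by omega
  rw [polygonElement, if_pos h, e]

theorem polygonElement_even (I₁ I₂ : G) (k : ℤ) :
    polygonElement I₁ I₂ (2 * k + 2) = (I₂ * I₁) ^ k * I₂ := by
  have h : ¬ Odd (2 * k + 2) := by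
    rw [Int.not_odd_iff_even]; exact ⟨k + 1, by ring⟩
  have e : (2 * k + 2 - 2) / 2 = k := by omega
  rw [polygonElement, if_neg h, e]

theorem polygonElement_one (I₁ I₂ : G) : polygonElement I₁ I₂ 1 = 1 := by
  simpa using polygonElement_odd I₁ I₂ 0

theorem polygonElement_add_eighteen {I₁ I₂ : G} (h : (I₂ * I₁) ^ 9 = 1) (j : ℤ) :
    polygonElement I₁ I₂ (j + 18) = polygonElement I₁ I₂ j := by
  have h9 : ∀ k : ℤ, (I₂ * I₁) ^ (k + 9) = (I₂ * I₁) ^ k := fun k => by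
    rw [zpow_add, show (9 : ℤ) = (9 : ℕ) from rfl, zpow_natCast, h, mul_one]
  rcases Int.even_or_odd' j with ⟨k, rfl | rfl⟩
  · rw [show 2 * k + 18 = 2 * ((k - 1) + 9) + 2 by ring, show 2 * k = 2 * (k - 1) + 2 by ring,
      polygonElement_even, polygonElement_even, h9]
  · rw [show 2 * k + 1 + 18 = 2 * (k + 9) + 1 by ring,
      polygonElement_odd, polygonElement_odd, h9]

/-- Right multiplication by a reflection passes to the adjacent triangle of the fan: `I₂` across one
of its two sides through the centre, `I₁` across the other. -/
theorem polygonElement_mul_right {I₁ I₂ : G} (h₂ : I₂ * I₂ = 1) (j : ℤ) :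
    polygonElement I₁ I₂ j * I₂ = polygonElement I₁ I₂ (if Odd j then j + 1 else j - 1) := by
  rcases Int.even_or_odd' j with ⟨k, rfl | rfl⟩
  · have h : ¬ Odd (2 * k) := by rw [Int.not_odd_iff_even]; exact ⟨k, by ring⟩
    rw [if_neg h, show 2 * k - 1 = 2 * (k - 1) + 1 by ring, show 2 * k = 2 * (k - 1) + 2 by ring,
      polygonElement_even, polygonElement_odd, mul_assoc, h₂, mul_one]
  · rw [if_pos ⟨k, rfl⟩, show 2 * k + 1 + 1 = 2 * k + 2 by ring, polygonElement_odd,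
      polygonElement_even]

theorem polygonElement_mul_left {I₁ I₂ : G} (h₁ : I₁ * I₁ = 1) (j : ℤ) :
    polygonElement I₁ I₂ j * I₁ = polygonElement I₁ I₂ (if Odd j then j - 1 else j + 1) := by
  rcases Int.even_or_odd' j with ⟨k, rfl | rfl⟩
  · have h : ¬ Odd (2 * k) := by rw [Int.not_odd_iff_even]; exact ⟨k, by ring⟩
    rw [if_neg h, polygonElement_odd, show 2 * k = 2 * (k - 1) + 2 by ring,
      polygonElement_even, mul_assoc, ← zpow_add_one, sub_add_cancel]
  · rw [if_pos ⟨k, rfl⟩, show 2 * k + 1 - 1 = 2 * (k - 1) + 2 by ring, polygonElement_odd,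
      polygonElement_even, zpow_sub_one, mul_inv_rev, mul_assoc, mul_assoc, inv_mul_cancel,
      mul_one, inv_eq_of_mul_eq_one_left h₁]

/-- The element of a group generated by the reflections `I₁, I₂, I₃` which pairs the sides
`sourceSide k` and `targetSide k`. -/
def pairingElement (I₁ I₂ I₃ : G) (k : Fin 9) : G :=
  polygonElement I₁ I₂ (targetSide k) * I₃ * (polygonElement I₁ I₂ (sourceSide k))⁻¹

/-- The relations, one for each vertex of the quotient surface, between the side pairings. -/
structure IsPairingFamily (s : Fin 9 → G) : Prop where
  rel₁ : s 0 * s 8 * s 5 = 1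
  rel₂ : s 1 * s 6 * s 2 = 1
  rel₃ : s 4 * s 7 * s 3 = 1
  rel₄ : s 1 * (s 4)⁻¹ * s 0 = 1
  rel₅ : s 2 * (s 3)⁻¹ * s 5 = 1
  rel₆ : s 6 * (s 7)⁻¹ * s 8 = 1

/-- The product telescopes to a conjugate of `(AB)³`. It records a full turn around a vertex with
angle `π/3`, which passes through three copies of the polygon. -/
theorem vertex_cycle {A B : G} (h : (A * B) ^ 3 = 1) (x y z : G) :
    (x * A * B * y⁻¹) * (y * A * B * z⁻¹) * (z * A * B * x⁻¹) = 1 := by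
  have : (x * A * B * y⁻¹) * (y * A * B * z⁻¹) * (z * A * B * x⁻¹) = x * (A * B) ^ 3 * x⁻¹ := by
    simp only [pow_succ, pow_zero, one_mul, mul_assoc, inv_mul_cancel_left]
  rw [this, h]; simp

/-- The first three relations come from vertices of the orbit of `A₁` and use `(I₁I₃)³ = 1`. The
others come from the orbit of `A₂` and use `(I₂I₃)³ = 1`; there one side is crossed backwards,
whence the inverse. -/
theorem isPairingFamily_pairingElement {I₁ I₂ I₃ : G} (h₁ : I₁ * I₁ = 1) (h₂ : I₂ * I₂ = 1)
    (h₃ : I₃ * I₃ = 1) (h₁₃ : (I₁ * I₃) ^ 3 = 1) (h₂₃ : (I₂ * I₃) ^ 3 = 1)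
    (h₂₁ : (I₂ * I₁) ^ 9 = 1) : IsPairingFamily (pairingElement I₁ I₂ I₃) := by
  have L : ∀ j k : ℤ, (if Odd j then j - 1 else j + 1) = k →
      polygonElement I₁ I₂ k = polygonElement I₁ I₂ j * I₁ := by
    rintro j k rfl; rw [polygonElement_mul_left h₁]
  have R : ∀ j k : ℤ, (if Odd j then j + 1 else j - 1) = k →
      polygonElement I₁ I₂ k = polygonElement I₁ I₂ j * I₂ := by
    rintro j k rfl; rw [polygonElement_mul_right h₂]
  have i₃ : I₃⁻¹ = I₃ := inv_eq_of_mul_eq_one_left h₃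
  have e18 : polygonElement I₁ I₂ 18 = polygonElement I₁ I₂ 1 * I₁ := by
    rw [← L 1 0 (by decide), ← polygonElement_add_eighteen h₂₁ 0]; rfl
  have V := fun x y z => vertex_cycle h₁₃ (polygonElement I₁ I₂ x) (polygonElement I₁ I₂ y)
    (polygonElement I₁ I₂ z)
  have V' := fun x y z => vertex_cycle h₂₃ (polygonElement I₁ I₂ x) (polygonElement I₁ I₂ y)
    (polygonElement I₁ I₂ z)
  constructor
  · have := V 7 1 13
    rwa [← L 7 6 (by decide), ← e18, ← L 13 12 (by decide)] at this
  · have := V 3 15 9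
    rwa [← L 3 2 (by decide), ← L 15 14 (by decide), ← L 9 8 (by decide)] at this
  · have := V 4 16 10
    rwa [← L 4 5 (by decide), ← L 16 17 (by decide), ← L 10 11 (by decide)] at this
  · have := V' 1 15 5
    rw [← R 1 2 (by decide), ← R 15 16 (by decide), ← R 5 6 (by decide)] at this
    rw [← this]
    simp only [pairingElement, mul_inv_rev, inv_inv, i₃, mul_assoc]
    rfl
  · have := V' 7 3 11
    rw [← R 7 8 (by decide), ← R 3 4 (by decide), ← R 11 12 (by decide)] at this
    simp only [pairingElement, mul_inv_rev, inv_inv, i₃]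
    have e := vertex_cycle h₂₃ (polygonElement I₁ I₂ 7) (polygonElement I₁ I₂ 3)
      (polygonElement I₁ I₂ 11)
    rw [← R 7 8 (by decide), ← R 3 4 (by decide), ← R 11 12 (by decide)] at e
    simp only [mul_assoc] at e ⊢
    exact e
  · have := V' 13 9 17
    rw [← R 13 14 (by decide), ← R 9 10 (by decide), ← R 17 18 (by decide)] at this
    simp only [pairingElement, mul_inv_rev, inv_inv, i₃]
    simp only [mul_assoc] at this ⊢
    exact this

end Polygon

/-- All nine words are conjugates of `sI` or `sIV` by powers of the rotation `I₂I₁`, and conjugating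
by its `m`-th power shifts both indices by `2m`. Indices out of range are brought back modulo 18. -/
theorem sidePairing_eq_pairingElement {I₁ I₂ I₃ : ℍ ≃ᵢ ℍ} (h₁ : I₁ * I₁ = 1) (h₂ : I₂ * I₂ = 1)
    (h₂₁ : (I₂ * I₁) ^ 9 = 1) (k : Fin 9) :
    sidePairing I₁ I₂ I₃ k = pairingElement I₁ I₂ I₃ k := by
  have hi : I₁ * I₂ = (I₂ * I₁)⁻¹ := by
    rw [mul_inv_rev, inv_eq_of_mul_eq_one_left h₁, inv_eq_of_mul_eq_one_left h₂]
  have i₂ : I₂⁻¹ = I₂ := inv_eq_of_mul_eq_one_left h₂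
  have O : ∀ j k : ℤ, 2 * k + 1 = j → polygonElement I₁ I₂ j = (I₂ * I₁) ^ k := by
    rintro j k rfl; exact polygonElement_odd I₁ I₂ k
  have E : ∀ j k : ℤ, 2 * k + 2 = j → polygonElement I₁ I₂ j = (I₂ * I₁) ^ k * I₂ := by
    rintro j k rfl; exact polygonElement_even I₁ I₂ k
  have P := polygonElement_add_eighteen h₂₁
  -- The index `-7` stands for `11` modulo 18.
  have hIV : sIV I₁ I₂ I₃ = polygonElement I₁ I₂ (-7) * I₃ * (polygonElement I₁ I₂ 4)⁻¹ := by
    have h4 : (I₂ * I₁) ^ (-4 : ℤ) = (I₁ * I₂) ^ 4 := by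
      rw [hi, inv_pow, zpow_neg]; rfl
    rw [O (-7) (-4) rfl, E 4 1 rfl, sIV, mul_inv_rev, i₂, zpow_one, ← hi, h4]
    simp only [mul_assoc]
  have hI : sI I₁ I₂ I₃ = polygonElement I₁ I₂ 6 * I₃ * (polygonElement I₁ I₂ 1)⁻¹ := by
    rw [O 1 0 rfl, E 6 2 rfl, sI]; group
  have cjO : ∀ (m : ℤ) (j : ℤ), (I₂ * I₁) ^ m * polygonElement I₁ I₂ j =
      polygonElement I₁ I₂ (2 * m + j) := by
    intro m j
    rcases Int.even_or_odd' j with ⟨k, rfl | rfl⟩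
    · rw [E (2 * k) (k - 1) (by ring), E (2 * m + 2 * k) (m + (k - 1)) (by ring), zpow_add,
        mul_assoc]
    · rw [O _ k rfl, O (2 * m + (2 * k + 1)) (m + k) (by ring), zpow_add]
  have cj : ∀ (m : ℤ) (i j : ℤ), (I₂ * I₁) ^ m *
      (polygonElement I₁ I₂ i * I₃ * (polygonElement I₁ I₂ j)⁻¹) * (I₂ * I₁) ^ (-m) =
      polygonElement I₁ I₂ (2 * m + i) * I₃ * (polygonElement I₁ I₂ (2 * m + j))⁻¹ := by
    intro m i j
    rw [← cjO, ← cjO, mul_inv_rev, zpow_neg]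
    simp only [mul_assoc]
  have c' : ∀ (m : ℕ) (g : ℍ ≃ᵢ ℍ), (I₁ * I₂) ^ m * g * (I₂ * I₁) ^ m =
      (I₂ * I₁) ^ (-m : ℤ) * g * (I₂ * I₁) ^ (-(-m : ℤ)) := by
    intro m g; rw [hi, inv_pow, zpow_neg, neg_neg, zpow_natCast]
  have c : ∀ (m : ℕ) (g : ℍ ≃ᵢ ℍ), (I₂ * I₁) ^ m * g * (I₁ * I₂) ^ m =
      (I₂ * I₁) ^ (m : ℤ) * g * (I₂ * I₁) ^ (-(m : ℤ)) := by
    intro m g; rw [hi, inv_pow, zpow_neg, zpow_natCast]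
  have c1 : ∀ (g : ℍ ≃ᵢ ℍ), (I₂ * I₁) * g * (I₁ * I₂) =
      (I₂ * I₁) ^ (1 : ℤ) * g * (I₂ * I₁) ^ (-(1 : ℤ)) := by
    intro g; rw [hi]; simp
  fin_cases k
  · exact hI
  · change (I₁ * I₂) ^ 2 * sI I₁ I₂ I₃ * (I₂ * I₁) ^ 2 =
      polygonElement I₁ I₂ 2 * I₃ * (polygonElement I₁ I₂ 15)⁻¹
    rw [hI, c', cj, ← P (2 * _ + 1)]; norm_num
  · change (I₂ * I₁) * sI I₁ I₂ I₃ * (I₁ * I₂) =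
      polygonElement I₁ I₂ 8 * I₃ * (polygonElement I₁ I₂ 3)⁻¹
    rw [hI, c1, cj]; norm_num
  · change sIV I₁ I₂ I₃ = polygonElement I₁ I₂ 11 * I₃ * (polygonElement I₁ I₂ 4)⁻¹
    rw [hIV, ← P (-7)]; norm_num
  · change (I₁ * I₂) ^ 3 * sIV I₁ I₂ I₃ * (I₂ * I₁) ^ 3 =
      polygonElement I₁ I₂ 5 * I₃ * (polygonElement I₁ I₂ 16)⁻¹
    rw [hIV, c', cj, ← P (2 * _ + 4), ← P (2 * _ + -7)]; norm_num
  · change (I₂ * I₁) ^ 3 * sI I₁ I₂ I₃ * (I₁ * I₂) ^ 3 =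
      polygonElement I₁ I₂ 12 * I₃ * (polygonElement I₁ I₂ 7)⁻¹
    rw [hI, c, cj]; norm_num
  · change (I₂ * I₁) ^ 4 * sI I₁ I₂ I₃ * (I₁ * I₂) ^ 4 =
      polygonElement I₁ I₂ 14 * I₃ * (polygonElement I₁ I₂ 9)⁻¹
    rw [hI, c, cj]; norm_num
  · change (I₂ * I₁) ^ 3 * sIV I₁ I₂ I₃ * (I₁ * I₂) ^ 3 =
      polygonElement I₁ I₂ 17 * I₃ * (polygonElement I₁ I₂ 10)⁻¹
    rw [hIV, c, cj, ← P (2 * _ + -7)]; norm_num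
  · change (I₁ * I₂) ^ 3 * sI I₁ I₂ I₃ * (I₂ * I₁) ^ 3 =
      polygonElement I₁ I₂ 18 * I₃ * (polygonElement I₁ I₂ 13)⁻¹
    rw [hI, c', cj, ← P (2 * _ + 1), ← P (2 * _ + 6)]; norm_num

/-! ### The sides of the polygon -/

theorem image_geodesicSegment (g : ℍ ≃ᵢ ℍ) (z w : ℍ) :
    g '' geodesicSegment z w = geodesicSegment (g z) (g w) := by
  ext x
  constructor
  · rintro ⟨y, hy, rfl⟩
    simpa [geodesicSegment, g.dist_eq] using hy
  · intro hx
    refine ⟨g.symm x, ?_, by simp⟩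
    have h1 := g.dist_eq z (g.symm x)
    have h2 := g.dist_eq (g.symm x) w
    simp only [IsometryEquiv.apply_symm_apply] at h1 h2
    change dist (g z) x + dist x (g w) = dist (g z) (g w) at hx
    change dist z (g.symm x) + dist (g.symm x) w = dist z w
    rw [← h1, ← h2, hx, g.dist_eq]

theorem geodesicSegment_comm (z w : ℍ) : geodesicSegment z w = geodesicSegment w z := by
  ext x
  change dist z x + dist x w = dist z w ↔ dist w x + dist x z = dist w z
  rw [add_comm, dist_comm x w, dist_comm z x, dist_comm z w]

theorem polygonSide_eq_image {I₁ I₂ : ℍ ≃ᵢ ℍ} {A₁ A₂ : ℍ} (h₁ : I₁ A₁ = A₁) (h₂ : I₂ A₂ = A₂)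
    (j : ℤ) : polygonSide I₁ I₂ A₁ A₂ j =
      (polygonElement I₁ I₂ j : ℍ ≃ᵢ ℍ) '' geodesicSegment A₁ A₂ := by
  rw [image_geodesicSegment, polygonSide]
  rcases Int.even_or_odd' j with ⟨k, rfl | rfl⟩
  · have h : ¬ Odd (2 * k) := by rw [Int.not_odd_iff_even]; exact ⟨k, by ring⟩
    have e : polygonElement I₁ I₂ (2 * k) = (I₂ * I₁) ^ (k - 1) * I₂ := by
      rw [← polygonElement_even]; ring_nf
    have e2 : (2 * k - 2) / 2 = k - 1 := by omega
    rw [polygonVertex, polygonVertex, if_neg h, if_pos ⟨k, rfl⟩, e, e2, geodesicSegment_comm]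
    have e3 : (2 * k + 1 - 1) / 2 = k - 1 + 1 := by omega
    rw [e3, zpow_add_one]
    change geodesicSegment (((I₂ * I₁) ^ (k - 1)) (I₂ (I₁ A₁))) _ =
      geodesicSegment (((I₂ * I₁) ^ (k - 1)) (I₂ A₁)) (((I₂ * I₁) ^ (k - 1)) (I₂ A₂))
    rw [h₁, h₂]
  · have h : ¬ Odd (2 * k + 1 + 1) := by rw [Int.not_odd_iff_even]; exact ⟨k + 1, by ring⟩
    have e2 : (2 * k + 1 + 1 - 2) / 2 = k := by omega
    have e3 : (2 * k + 1 - 1) / 2 = k := by omega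
    rw [polygonVertex, polygonVertex, if_neg h, if_pos ⟨k, rfl⟩, polygonElement_odd, e2, e3]

/-- Carry the source side back to the base `[A₁A₂]`, which `I₃` fixes pointwise at its endpoints,
and forward to the target side. -/
theorem pairingElement_image_polygonSide {I₁ I₂ I₃ : ℍ ≃ᵢ ℍ} {A₁ A₂ : ℍ} (h₁ : I₁ A₁ = A₁)
    (h₂ : I₂ A₂ = A₂) (h₃₁ : I₃ A₁ = A₁) (h₃₂ : I₃ A₂ = A₂) (k : Fin 9) :
    (pairingElement I₁ I₂ I₃ k : ℍ ≃ᵢ ℍ) '' polygonSide I₁ I₂ A₁ A₂ (sourceSide k) =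
      polygonSide I₁ I₂ A₁ A₂ (targetSide k) := by
  rw [polygonSide_eq_image h₁ h₂, polygonSide_eq_image h₁ h₂, ← Set.image_comp]
  have : ∀ g w : ℍ ≃ᵢ ℍ, (g * I₃ * w⁻¹) '' (w '' geodesicSegment A₁ A₂) =
      g '' geodesicSegment A₁ A₂ := by
    intro g w
    rw [image_geodesicSegment, image_geodesicSegment, image_geodesicSegment]
    simp only [IsometryEquiv.mul_apply, IsometryEquiv.inv_apply_self, h₃₁, h₃₂]
  rw [Set.image_comp]
  exact this _ _

/-! ## The Coxeter group of type (3, 3, 9) and its action on 18 cosets -/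

/-- The Coxeter matrix of the triangle group with angles `π/3`, `π/3`, `π/9`. -/
def coxeterMatrix339 : CoxeterMatrix (Fin 3) where
  M := !![1, 9, 3; 9, 1, 3; 3, 3, 1]
  off_diagonal i j h := by fin_cases i <;> fin_cases j <;> simp_all

/-- The triangle group with angles `π/3`, `π/3`, `π/9`, as an abstract Coxeter group. -/
abbrev Coxeter339 : Type := coxeterMatrix339.Group

/-- The standard Coxeter system on `Coxeter339`. -/
abbrev coxeterSystem339 : CoxeterSystem coxeterMatrix339 Coxeter339 :=
  coxeterMatrix339.toCoxeterSystem

/-- The standard generators of `Coxeter339`. -/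
abbrev reflection339 (i : Fin 3) : Coxeter339 := coxeterSystem339.simple i

theorem isLiftable339_iff {G : Type*} [Monoid G] (f : Fin 3 → G) :
    coxeterMatrix339.IsLiftable f ↔ (∀ i, f i * f i = 1) ∧ (f 0 * f 1) ^ 9 = 1 ∧
      (f 1 * f 0) ^ 9 = 1 ∧ (f 0 * f 2) ^ 3 = 1 ∧ (f 2 * f 0) ^ 3 = 1 ∧ (f 1 * f 2) ^ 3 = 1 ∧
      (f 2 * f 1) ^ 3 = 1 := by
  simp only [CoxeterMatrix.IsLiftable, Fin.forall_fin_succ]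
  simp [coxeterMatrix339]
  tauto

theorem isLiftable339 {G : Type*} [Group G] {f : Fin 3 → G} (h : ∀ i, f i * f i = 1)
    (h₀₁ : (f 0 * f 1) ^ 9 = 1) (h₀₂ : (f 0 * f 2) ^ 3 = 1) (h₁₂ : (f 1 * f 2) ^ 3 = 1) :
    coxeterMatrix339.IsLiftable f := by
  have inv : ∀ i, (f i)⁻¹ = f i := fun i => inv_eq_of_mul_eq_one_left (h i)
  have sw : ∀ i j n, (f i * f j) ^ n = 1 → (f j * f i) ^ n = 1 := by
    intro i j n hn
    have : f j * f i = (f i * f j)⁻¹ := by rw [mul_inv_rev, inv, inv]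
    rw [this, inv_pow, hn, inv_one]
  exact (isLiftable339_iff f).2 ⟨h, h₀₁, sw _ _ _ h₀₁, h₀₂, sw _ _ _ h₀₂, h₁₂, sw _ _ _ h₁₂⟩

theorem relations339 : (∀ i, reflection339 i * reflection339 i = 1) ∧
    (reflection339 0 * reflection339 1) ^ 9 = 1 ∧ (reflection339 1 * reflection339 0) ^ 9 = 1 ∧
    (reflection339 0 * reflection339 2) ^ 3 = 1 ∧ (reflection339 2 * reflection339 0) ^ 3 = 1 ∧
    (reflection339 1 * reflection339 2) ^ 3 = 1 ∧ (reflection339 2 * reflection339 1) ^ 3 = 1 :=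
  (isLiftable339_iff reflection339).1 coxeterSystem339.simple_mul_simple_pow

/-! ### The permutation representation twisted by a pairing family -/

section Twist

variable {S : Type*} [Group S]

/-- The permutation `(j, x) ↦ (σ j, κ j * x)`. -/
def twistPerm (σ : Equiv.Perm (Fin 18)) (κ : Fin 18 → S) : Equiv.Perm (Fin 18 × S) where
  toFun p := (σ p.1, κ p.1 * p.2)
  invFun p := (σ.symm p.1, (κ (σ.symm p.1))⁻¹ * p.2)
  left_inv p := by simp
  right_inv p := by simp

theorem twistPerm_apply (σ : Equiv.Perm (Fin 18)) (κ : Fin 18 → S) (p : Fin 18 × S) :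
    twistPerm σ κ p = (σ p.1, κ p.1 * p.2) := rfl

theorem twistPerm_mul (σ τ : Equiv.Perm (Fin 18)) (κ μ : Fin 18 → S) :
    twistPerm σ κ * twistPerm τ μ = twistPerm (σ * τ) (fun j => κ (τ j) * μ j) := by
  ext p <;> simp [twistPerm_apply, mul_assoc]

theorem twistPerm_eq_one {σ : Equiv.Perm (Fin 18)} {κ : Fin 18 → S} (hσ : σ = 1)
    (hκ : ∀ j, κ j = 1) : twistPerm σ κ = 1 := by
  ext p <;> simp [twistPerm_apply, hσ, hκ]

theorem twistPerm_one_pow (σ : Equiv.Perm (Fin 18)) (n : ℕ) :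
    twistPerm σ (fun _ => (1 : S)) ^ n = twistPerm (σ ^ n) (fun _ => 1) := by
  induction n with
  | zero => rw [pow_zero, pow_zero, twistPerm_eq_one rfl fun _ => rfl]
  | succ n ih => rw [pow_succ, ih, twistPerm_mul, pow_succ]; simp

/-- The reflection in the side of the triangle on `L₁`, on the triangles of the polygon. -/
def cosetPerm₁ : Equiv.Perm (Fin 18) where
  toFun j := if j.1 % 2 = 0 then j - 1 else j + 1
  invFun j := if j.1 % 2 = 0 then j - 1 else j + 1
  left_inv := by decide
  right_inv := by decide

/-- The reflection in the side of the triangle on `L₂`, on the triangles of the polygon. -/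
def cosetPerm₂ : Equiv.Perm (Fin 18) where
  toFun j := if j.1 % 2 = 0 then j + 1 else j - 1
  invFun j := if j.1 % 2 = 0 then j + 1 else j - 1
  left_inv := by decide
  right_inv := by decide

/-- The reflection in the side of the triangle on `L₃`, on the triangles of the polygon: it is given
by the pairing of the sides. -/
def cosetPerm₃ : Equiv.Perm (Fin 18) where
  toFun := ![5, 14, 7, 10, 15, 0, 11, 2, 13, 16, 3, 6, 17, 8, 1, 4, 9, 12]
  invFun := ![5, 14, 7, 10, 15, 0, 11, 2, 13, 16, 3, 6, 17, 8, 1, 4, 9, 12]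
  left_inv := by decide
  right_inv := by decide

/-- The side pairing which is applied when a path leaves a triangle through the polygon's side. -/
def sideLabel (s : Fin 9 → S) : Fin 18 → S :=
  ![s 0, (s 1)⁻¹, s 2, s 3, (s 4)⁻¹, (s 0)⁻¹, s 5, (s 2)⁻¹, s 6, s 7, (s 3)⁻¹, (s 5)⁻¹, s 8,
    (s 6)⁻¹, s 1, s 4, (s 7)⁻¹, (s 8)⁻¹]

/-- The action of the generators of the triangle group on `Fin 18 × S`. -/
def pairingPerm (s : Fin 9 → S) : Fin 3 → Equiv.Perm (Fin 18 × S) :=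
  ![twistPerm cosetPerm₁ fun _ => 1, twistPerm cosetPerm₂ fun _ => 1,
    twistPerm cosetPerm₃ (sideLabel s)]

theorem mul_rotate_eq_one {a b c : S} (h : a * b * c = 1) : b * c * a = 1 := by
  have : b * c = a⁻¹ := by
    rw [mul_assoc] at h
    exact eq_inv_of_mul_eq_one_right h
  rw [this, inv_mul_cancel]

theorem inv_mul_inv_mul_inv_eq_one {a b c : S} (h : a * b * c = 1) : c⁻¹ * b⁻¹ * a⁻¹ = 1 := by
  rw [← inv_one, ← h]; simp [mul_assoc]

/-- Turning around the centre collects no labels, and crossing a side twice collects a label and its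
inverse. Turning around a vertex of the polygon collects a vertex relation, up to inversion and
cyclic rotation. -/
theorem isLiftable_pairingPerm {s : Fin 9 → S} (hs : IsPairingFamily s) :
    coxeterMatrix339.IsLiftable (pairingPerm s) := by
  have inv₃ : ∀ j, sideLabel s (cosetPerm₃ j) * sideLabel s j = 1 := by
    intro j
    fin_cases j <;> simp [sideLabel, cosetPerm₃]
  have c₁ := mul_rotate_eq_one hs.rel₁
  have c₂ := mul_rotate_eq_one hs.rel₂
  have c₃ := mul_rotate_eq_one hs.rel₃
  have c₄ := mul_rotate_eq_one hs.rel₄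
  have c₅ := mul_rotate_eq_one hs.rel₅
  have c₆ := mul_rotate_eq_one hs.rel₆
  have d₁ := mul_rotate_eq_one c₁
  have d₂ := mul_rotate_eq_one c₂
  have d₃ := mul_rotate_eq_one c₃
  have d₄ := mul_rotate_eq_one c₄
  have d₅ := mul_rotate_eq_one c₅
  have d₆ := mul_rotate_eq_one c₆
  have cube : ∀ σ : Equiv.Perm (Fin 18), (σ * cosetPerm₃) ^ 3 = 1 →
      (∀ j, sideLabel s (σ (cosetPerm₃ (σ (cosetPerm₃ j)))) * sideLabel s (σ (cosetPerm₃ j)) *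
        sideLabel s j = 1) →
      (twistPerm σ (fun _ => (1 : S)) * twistPerm cosetPerm₃ (sideLabel s)) ^ 3 = 1 := by
    intro σ hσ h
    rw [twistPerm_mul, pow_succ, pow_two, twistPerm_mul, twistPerm_mul]
    refine twistPerm_eq_one ?_ ?_
    · rw [← hσ]; rfl
    · intro j
      simpa [mul_assoc] using h j
  refine isLiftable339 ?_ ?_ ?_ ?_
  · intro i
    fin_cases i
    · exact (twistPerm_mul _ _ (fun _ => 1) fun _ => 1).trans (twistPerm_eq_one (σ := cosetPerm₁ * cosetPerm₁)
        (by decide) fun _ => mul_one 1)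
    · exact (twistPerm_mul _ _ (fun _ => 1) fun _ => 1).trans (twistPerm_eq_one (σ := cosetPerm₂ * cosetPerm₂)
        (by decide) fun _ => mul_one 1)
    · exact (twistPerm_mul _ _ _ _).trans (twistPerm_eq_one (σ := cosetPerm₃ * cosetPerm₃)
        (by decide) inv₃)
  · change (twistPerm cosetPerm₁ (fun _ => (1 : S)) * twistPerm cosetPerm₂ (fun _ => 1)) ^ 9 = 1
    rw [twistPerm_mul]
    simp only [mul_one]
    rw [twistPerm_one_pow]
    exact twistPerm_eq_one (by decide) fun _ => rfl
  · refine cube cosetPerm₁ (by decide) fun j => ?_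
    -- The 18 starting triangles correspond to three relations, each with three cyclic rotations and
    -- two orientations.
    have i₁ := inv_mul_inv_mul_inv_eq_one c₁
    have i₂ := inv_mul_inv_mul_inv_eq_one c₂
    have i₃ := inv_mul_inv_mul_inv_eq_one c₃
    have j₁ := inv_mul_inv_mul_inv_eq_one d₁
    have j₂ := inv_mul_inv_mul_inv_eq_one d₂
    have j₃ := inv_mul_inv_mul_inv_eq_one d₃
    have k₁ := inv_mul_inv_mul_inv_eq_one hs.rel₁
    have k₂ := inv_mul_inv_mul_inv_eq_one hs.rel₂
    have k₃ := inv_mul_inv_mul_inv_eq_one hs.rel₃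
    have r₁ := hs.rel₁
    have r₂ := hs.rel₂
    have r₃ := hs.rel₃
    fin_cases j <;> simp only [sideLabel, cosetPerm₃, cosetPerm₁] <;> assumption
  · refine cube cosetPerm₂ (by decide) fun j => ?_
    have i₁ := inv_mul_inv_mul_inv_eq_one c₄
    have i₂ := inv_mul_inv_mul_inv_eq_one c₅
    have i₃ := inv_mul_inv_mul_inv_eq_one c₆
    have j₁ := inv_mul_inv_mul_inv_eq_one d₄
    have j₂ := inv_mul_inv_mul_inv_eq_one d₅
    have j₃ := inv_mul_inv_mul_inv_eq_one d₆
    have k₁ := inv_mul_inv_mul_inv_eq_one hs.rel₄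
    have k₂ := inv_mul_inv_mul_inv_eq_one hs.rel₅
    have k₃ := inv_mul_inv_mul_inv_eq_one hs.rel₆
    have r₁ := hs.rel₄
    have r₂ := hs.rel₅
    have r₃ := hs.rel₆
    rw [inv_inv] at i₁ i₂ i₃ j₁ j₂ j₃ k₁ k₂ k₃
    fin_cases j <;> simp only [sideLabel, cosetPerm₃, cosetPerm₂] <;> assumption

/-- The action of the triangle group on `Fin 18 × S` given by a pairing family in `S`. -/
noncomputable def pairingAction {s : Fin 9 → S} (hs : IsPairingFamily s) :
    Coxeter339 →* Equiv.Perm (Fin 18 × S) :=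
  coxeterSystem339.lift ⟨pairingPerm s, isLiftable_pairingPerm hs⟩

theorem pairingAction_reflection {s : Fin 9 → S} (hs : IsPairingFamily s) (i : Fin 3) :
    pairingAction hs (reflection339 i) = pairingPerm s i :=
  coxeterSystem339.lift_apply_simple _ i

end Twist

/-- The action of the generators of the triangle group on the 18 cosets. -/
def cosetPerm : Fin 3 → Equiv.Perm (Fin 18) := ![cosetPerm₁, cosetPerm₂, cosetPerm₃]

/-- The action of the triangle group on the 18 cosets. -/
noncomputable def cosetAction : Coxeter339 →* Equiv.Perm (Fin 18) :=
  coxeterSystem339.lift ⟨cosetPerm, isLiftable339 (by decide) (by decide) (by decide) (by decide)⟩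

theorem cosetAction_reflection (i : Fin 3) : cosetAction (reflection339 i) = cosetPerm i :=
  coxeterSystem339.lift_apply_simple _ i

/-! ## The surface subgroup of the abstract triangle group -/

/-- The elements `polygonElement` of the abstract triangle group. -/
abbrev polygonElement339 (j : ℤ) : Coxeter339 :=
  polygonElement (reflection339 0) (reflection339 1) j

/-- The side pairings, as elements of the abstract triangle group. -/
abbrev pairingElement339 : Fin 9 → Coxeter339 :=
  pairingElement (reflection339 0) (reflection339 1) (reflection339 2)

/-- The subgroup of the abstract triangle group which is generated by the side pairings. -/
def surfaceSubgroup339 : Subgroup Coxeter339 :=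
  Subgroup.closure (Set.range pairingElement339)

theorem pairingElement339_mem (k : Fin 9) : pairingElement339 k ∈ surfaceSubgroup339 :=
  Subgroup.subset_closure ⟨k, rfl⟩

theorem isPairingFamily339 : IsPairingFamily pairingElement339 :=
  isPairingFamily_pairingElement (relations339.1 0) (relations339.1 1) (relations339.1 2)
    relations339.2.2.2.1 relations339.2.2.2.2.2.1 relations339.2.2.1

/-! ### Effect of the polygon elements and side pairings on triangles and labels -/

section Action

variable {S : Type*} [Group S] {s : Fin 9 → S} (hs : IsPairingFamily s)

theorem pairingAction_fst (w : Coxeter339) (p : Fin 18 × S) :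
    (pairingAction hs w p).1 = cosetAction w p.1 := by
  induction w using coxeterSystem339.simple_induction_left generalizing p with
  | one => simp
  | mul_simple_left w i ih =>
    rw [map_mul, map_mul, Equiv.Perm.mul_apply, Equiv.Perm.mul_apply, ← ih,
      pairingAction_reflection, cosetAction_reflection]
    fin_cases i <;> rfl

/-- Only the reflections in `L₁` and `L₂` occur, so the path stays inside the polygon and the label
is unchanged. The element is inverted because `W` acts on the left, while triangles up to `Γ` are
right cosets; index `n + 1` corresponds to `n : Fin 18`. -/
theorem pairingAction_polygonElement_inv (n : ℕ) (x : S) :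
    pairingAction hs (polygonElement339 (n + 1))⁻¹ (0, x) = (Fin.ofNat 18 n, x) := by
  induction n with
  | zero => simp [polygonElement_one]
  | succ n ih =>
    have inv : ∀ i, (reflection339 i)⁻¹ = reflection339 i := coxeterSystem339.inv_simple
    have h₁ := polygonElement_mul_left (I₂ := reflection339 1) (relations339.1 0) (n + 1)
    have h₂ := polygonElement_mul_right (I₁ := reflection339 0) (relations339.1 1) (n + 1)
    rcases Nat.even_or_odd n with hn | hn
    · have ho : Odd ((n : ℤ) + 1) := by
        obtain ⟨k, rfl⟩ := hn; exact ⟨k, by push_cast; ring⟩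
      rw [if_pos ho] at h₂
      push_cast
      rw [polygonElement339, ← h₂, mul_inv_rev, map_mul, Equiv.Perm.mul_apply, ih, inv,
        pairingAction_reflection]
      have : ∀ m : Fin 18, m.1 % 2 = 0 → cosetPerm₂ m = m + 1 := by decide
      change (cosetPerm₂ (Fin.ofNat 18 n), 1 * x) = _
      rw [this, one_mul]
      · simp [Fin.ofNat, Fin.add_def]
      · change n % 18 % 2 = _
        rw [Nat.mod_mod_of_dvd _ (by norm_num), Nat.even_iff.1 hn]
    · have ho : ¬ Odd ((n : ℤ) + 1) := by
        rw [Int.not_odd_iff_even]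
        obtain ⟨k, rfl⟩ := hn; exact ⟨k + 1, by push_cast; ring⟩
      rw [if_neg ho] at h₁
      push_cast
      rw [polygonElement339, ← h₁, mul_inv_rev, map_mul, Equiv.Perm.mul_apply, ih, inv,
        pairingAction_reflection]
      have : ∀ m : Fin 18, m.1 % 2 = 1 → cosetPerm₁ m = m + 1 := by decide
      change (cosetPerm₁ (Fin.ofNat 18 n), 1 * x) = _
      rw [this, one_mul]
      · simp [Fin.ofNat, Fin.add_def]
      · change n % 18 % 2 = _
        rw [Nat.mod_mod_of_dvd _ (by norm_num), Nat.odd_iff.1 hn]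

theorem pairingAction_polygonElement (n : ℕ) (x : S) :
    pairingAction hs (polygonElement339 (n + 1)) (Fin.ofNat 18 n, x) = (0, x) := by
  rw [← pairingAction_polygonElement_inv hs, ← Equiv.Perm.mul_apply, ← map_mul, mul_inv_cancel,
    map_one]
  rfl

/-- The path goes from the first triangle to the source triangle, crosses its side with label `s k`,
and returns from the target triangle; only the crossing changes the label. -/
theorem pairingAction_pairingElement (k : Fin 9) (x : S) :
    pairingAction hs (pairingElement339 k) (0, x) = (0, s k * x) := by
  have key : ∀ (a b : ℕ) (c : Fin 9), sourceSide c = a + 1 → targetSide c = b + 1 →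
      cosetPerm₃ (Fin.ofNat 18 a) = Fin.ofNat 18 b → sideLabel s (Fin.ofNat 18 a) = s c →
      pairingAction hs (pairingElement339 c) (0, x) = (0, s c * x) := by
    intro a b c ha hb hab hc
    rw [pairingElement339, pairingElement, ha, hb, map_mul, map_mul, Equiv.Perm.mul_apply,
      Equiv.Perm.mul_apply, pairingAction_polygonElement_inv, pairingAction_reflection]
    change pairingAction hs _ (cosetPerm₃ (Fin.ofNat 18 a), sideLabel s (Fin.ofNat 18 a) * x) = _
    rw [hab, hc, pairingAction_polygonElement]
  fin_cases k
  · exact key 0 5 0 rfl rfl rfl rfl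
  · exact key 14 1 1 rfl rfl rfl rfl
  · exact key 2 7 2 rfl rfl rfl rfl
  · exact key 3 10 3 rfl rfl rfl rfl
  · exact key 15 4 4 rfl rfl rfl rfl
  · exact key 6 11 5 rfl rfl rfl rfl
  · exact key 8 13 6 rfl rfl rfl rfl
  · exact key 9 16 7 rfl rfl rfl rfl
  · exact key 12 17 8 rfl rfl rfl rfl

end Action

/-! ### The surface subgroup as the stabilizer of a triangle -/

theorem cosetAction_polygonElement_inv (j : Fin 18) :
    cosetAction (polygonElement339 (j + 1))⁻¹ 0 = j := by
  have := pairingAction_polygonElement_inv isPairingFamily339 j 1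
  have := congrArg Prod.fst this
  rw [pairingAction_fst] at this
  simpa using this

theorem cosetAction_eq_zero_of_mem {w : Coxeter339} (hw : w ∈ surfaceSubgroup339) :
    cosetAction w 0 = 0 := by
  have : surfaceSubgroup339 ≤ (MulAction.stabilizer (Equiv.Perm (Fin 18)) (0 : Fin 18)).comap
      cosetAction := by
    rw [surfaceSubgroup339, Subgroup.closure_le]
    rintro _ ⟨k, rfl⟩
    have := congrArg Prod.fst (pairingAction_pairingElement isPairingFamily339 k 1)
    rwa [pairingAction_fst] at this
  exact this hw

/-- These are the Schreier generators for the transversal formed by the polygon elements. For `i =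
0, 1` they are trivial; for `i = 2` they are side pairings or inverses of side pairings. -/
theorem polygonElement_mul_reflection_mem (j : Fin 18) (i : Fin 3) :
    polygonElement339 (cosetPerm i j + 1) * reflection339 i * (polygonElement339 (j + 1))⁻¹ ∈
      surfaceSubgroup339 := by
  have h₁ := fun j => polygonElement_mul_left (I₂ := reflection339 1) (relations339.1 0) j
  have h₂ := fun j => polygonElement_mul_right (I₁ := reflection339 0) (relations339.1 1) j
  have per := polygonElement_add_eighteen relations339.2.2.1
  have triv : ∀ j k : ℤ, ∀ g, polygonElement339 j * g = polygonElement339 k →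
      polygonElement339 j * g * (polygonElement339 k)⁻¹ ∈ surfaceSubgroup339 := by
    intro j k g h
    rw [h, mul_inv_cancel]
    exact one_mem _
  have inv₂ : (reflection339 2)⁻¹ = reflection339 2 := coxeterSystem339.inv_simple 2
  have inv : ∀ a b : ℤ, polygonElement339 a * reflection339 2 * (polygonElement339 b)⁻¹ ∈
      surfaceSubgroup339 → polygonElement339 b * reflection339 2 * (polygonElement339 a)⁻¹ ∈
      surfaceSubgroup339 := by
    intro a b h
    have := inv_mem h
    rwa [mul_inv_rev, mul_inv_rev, inv_inv, inv₂, ← mul_assoc] at this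
  match i with
  | 0 =>
    apply triv
    rw [h₁]
    have per0 : polygonElement339 0 = polygonElement339 18 := by
      simpa using (per 0).symm
    have per1 : polygonElement339 19 = polygonElement339 1 := by
      simpa using (per 1)
    fin_cases j <;> first | exact per1 | exact per0 | rfl
  | 1 =>
    apply triv
    rw [h₂]
    fin_cases j <;> rfl
  | 2 =>
    have m := pairingElement339_mem
    fin_cases j
    · exact m 0
    · exact inv 2 15 (m 1)
    · exact m 2
    · exact m 3
    · exact inv 5 16 (m 4)
    · exact inv 6 1 (m 0)
    · exact m 5
    · exact inv 8 3 (m 2)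
    · exact m 6
    · exact m 7
    · exact inv 11 4 (m 3)
    · exact inv 12 7 (m 5)
    · exact m 8
    · exact inv 14 9 (m 6)
    · exact m 1
    · exact m 4
    · exact inv 17 10 (m 7)
    · exact inv 18 13 (m 8)

theorem polygonElement_mul_mem (w : Coxeter339) :
    polygonElement339 (cosetAction w 0 + 1) * w ∈ surfaceSubgroup339 := by
  induction w using coxeterSystem339.simple_induction_left with
  | one => simp [polygonElement_one, one_mem]
  | mul_simple_left w i ih =>
    have := mul_mem (polygonElement_mul_reflection_mem (cosetAction w 0) i) ih
    rw [map_mul, Equiv.Perm.mul_apply, cosetAction_reflection]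
    rwa [mul_assoc, inv_mul_cancel_left, mul_assoc] at this

theorem mem_surfaceSubgroup339_iff {w : Coxeter339} :
    w ∈ surfaceSubgroup339 ↔ cosetAction w 0 = 0 := by
  refine ⟨cosetAction_eq_zero_of_mem, fun h => ?_⟩
  have := polygonElement_mul_mem w
  rw [h] at this
  simpa [polygonElement_one] using this

theorem surfaceSubgroup339_index : surfaceSubgroup339.index = 18 := by
  let _ := MulAction.compHom (Fin 18) cosetAction
  have hst : surfaceSubgroup339 = MulAction.stabilizer Coxeter339 (0 : Fin 18) := by
    ext w
    rw [mem_surfaceSubgroup339_iff]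
    rfl
  have : MulAction.IsPretransitive Coxeter339 (Fin 18) := by
    rw [MulAction.isPretransitive_iff_orbit_eq_univ (0 : Fin 18)]
    ext j
    simp only [Set.mem_univ, iff_true]
    exact ⟨_, cosetAction_polygonElement_inv j⟩
  rw [hst, MulAction.index_stabilizer_of_transitive]
  simp

/-! ### The isomorphism with the surface group -/

/-- The images of the nine side pairings in the surface group of genus 2. -/
def surfacePairing {S : Type*} [Group S] (a₁ b₁ a₂ b₂ : S) : Fin 9 → S :=
  ![a₁, b₁, b₁⁻¹ * b₂⁻¹, (b₁⁻¹ * a₂⁻¹ * b₁) * (b₁⁻¹ * b₂⁻¹), a₁ * b₁, b₁⁻¹ * a₂⁻¹ * b₁,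
    b₁⁻¹ * (b₁⁻¹ * b₂⁻¹)⁻¹, (a₁⁻¹ * (b₁⁻¹ * a₂⁻¹ * b₁)⁻¹) * (b₁⁻¹ * (b₁⁻¹ * b₂⁻¹)⁻¹),
    a₁⁻¹ * (b₁⁻¹ * a₂⁻¹ * b₁)⁻¹]

/-- The expressions are built so that every relation except `rel₃` holds in the free group, and
`rel₃` becomes the surface relation. -/
theorem isPairingFamily_surfacePairing {S : Type*} [Group S] {a₁ b₁ a₂ b₂ : S}
    (h : a₁ * b₁ * a₁⁻¹ * b₁⁻¹ * (a₂ * b₂ * a₂⁻¹ * b₂⁻¹) = 1) :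
    IsPairingFamily (surfacePairing a₁ b₁ a₂ b₂) where
  rel₁ := by simp [surfacePairing, mul_assoc]
  rel₂ := by simp [surfacePairing, mul_assoc]
  rel₃ := by
    rw [← h]; simp [surfacePairing, mul_assoc]
  rel₄ := by simp [surfacePairing, mul_assoc]
  rel₅ := by simp [surfacePairing, mul_assoc]
  rel₆ := by simp [surfacePairing, mul_assoc]

/-- All relations except `rel₃` express `s 3`, `s 4`, `s 6`, `s 7`, `s 8` through `s 0`, `s 1`, `s
2`, `s 5`. The new variables `a₂`, `b₂` are chosen to turn the remaining relator into a product of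
commutators. -/
theorem IsPairingFamily.eq_surfacePairing {G : Type*} [Group G] {s : Fin 9 → G}
    (hs : IsPairingFamily s) : s = surfacePairing (s 0) (s 1) (s 1 * (s 5)⁻¹ * (s 1)⁻¹)
      ((s 2)⁻¹ * (s 1)⁻¹) := by
  have h8 : s 8 = (s 0)⁻¹ * (s 5)⁻¹ := by
    rw [eq_inv_mul_iff_mul_eq]; exact eq_inv_of_mul_eq_one_left hs.rel₁
  have h6 : s 6 = (s 1)⁻¹ * (s 2)⁻¹ := by
    rw [eq_inv_mul_iff_mul_eq]; exact eq_inv_of_mul_eq_one_left hs.rel₂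
  have h4 : s 4 = s 0 * s 1 := by
    have := mul_rotate_eq_one (mul_rotate_eq_one hs.rel₄)
    exact (mul_inv_eq_one.1 this).symm
  have h3 : s 3 = s 5 * s 2 := by
    have := mul_rotate_eq_one (mul_rotate_eq_one hs.rel₅)
    exact (mul_inv_eq_one.1 this).symm
  have h7 : s 7 = s 8 * s 6 := by
    have := mul_rotate_eq_one (mul_rotate_eq_one hs.rel₆)
    exact (mul_inv_eq_one.1 this).symm
  funext k
  fin_cases k <;> simp [surfacePairing, h8, h6, h4, h3, h7, mul_assoc]

theorem IsPairingFamily.commutator_relation {G : Type*} [Group G] {a₁ b₁ a₂ b₂ : G}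
    (hs : IsPairingFamily (surfacePairing a₁ b₁ a₂ b₂)) :
    a₁ * b₁ * a₁⁻¹ * b₁⁻¹ * (a₂ * b₂ * a₂⁻¹ * b₂⁻¹) = 1 := by
  rw [← hs.rel₃]; simp [surfacePairing, mul_assoc]

section SurfaceGroup

theorem surfaceRelator_two : surfaceRelator 2 =
    FreeGroup.of (0, false) * FreeGroup.of (0, true) * (FreeGroup.of (0, false))⁻¹ *
        (FreeGroup.of (0, true))⁻¹ *
      (FreeGroup.of (1, false) * FreeGroup.of (1, true) * (FreeGroup.of (1, false))⁻¹ *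
        (FreeGroup.of (1, true))⁻¹) := by
  simp [surfaceRelator, mul_assoc]

/-- The standard generators of the surface group of genus 2. -/
def surfaceGenerator (x : Fin 2 × Bool) : SurfaceGroup 2 := PresentedGroup.of x

theorem isPairingFamily_surfaceGenerator : IsPairingFamily
    (surfacePairing (surfaceGenerator (0, false)) (surfaceGenerator (0, true))
      (surfaceGenerator (1, false)) (surfaceGenerator (1, true))) := by
  apply isPairingFamily_surfacePairing
  have : (PresentedGroup.mk {surfaceRelator 2}) (surfaceRelator 2) = 1 :=
    PresentedGroup.one_of_mem rfl
  have h := congrArg (PresentedGroup.mk {surfaceRelator 2}) surfaceRelator_two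
  rw [this] at h
  simp only [map_mul, map_inv] at h
  exact h.symm

/-- The images in the triangle group of the standard generators of the surface group. -/
def surfaceGeneratorImage (x : Fin 2 × Bool) : Coxeter339 :=
  match x with
  | (0, false) => pairingElement339 0
  | (0, true) => pairingElement339 1
  | (1, false) => pairingElement339 1 * (pairingElement339 5)⁻¹ * (pairingElement339 1)⁻¹
  | (1, true) => (pairingElement339 2)⁻¹ * (pairingElement339 1)⁻¹

theorem pairingElement339_eq_surfacePairing : pairingElement339 =
    surfacePairing (surfaceGeneratorImage (0, false)) (surfaceGeneratorImage (0, true))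
      (surfaceGeneratorImage (1, false)) (surfaceGeneratorImage (1, true)) :=
  isPairingFamily339.eq_surfacePairing

/-- The homomorphism from the surface group of genus 2 to the triangle group. -/
def surfaceGroupHom : SurfaceGroup 2 →* Coxeter339 :=
  PresentedGroup.toGroup (f := surfaceGeneratorImage) (by
    rintro _ rfl
    have h := isPairingFamily339
    rw [pairingElement339_eq_surfacePairing] at h
    rw [surfaceRelator_two]
    simpa only [map_mul, map_inv, FreeGroup.lift_apply_of] using h.commutator_relation)

theorem surfaceGroupHom_generator (x : Fin 2 × Bool) :
    surfaceGroupHom (surfaceGenerator x) = surfaceGeneratorImage x :=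
  PresentedGroup.toGroup.of _

theorem map_surfacePairing {G H : Type*} [Group G] [Group H] (φ : G →* H) (a₁ b₁ a₂ b₂ : G) :
    ∀ k, φ (surfacePairing a₁ b₁ a₂ b₂ k) = surfacePairing (φ a₁) (φ b₁) (φ a₂) (φ b₂) k := by
  intro k
  fin_cases k <;> simp [surfacePairing]

theorem surfaceGroupHom_range : surfaceGroupHom.range = surfaceSubgroup339 := by
  apply le_antisymm
  · rintro _ ⟨x, rfl⟩
    have hx : x ∈ Subgroup.closure (Set.range surfaceGenerator) := by
      have := PresentedGroup.closure_range_of ({surfaceRelator 2} : Set (FreeGroup (Fin 2 × Bool)))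
      change x ∈ Subgroup.closure (Set.range (PresentedGroup.of))
      rw [this]
      trivial
    have hle : Subgroup.closure (Set.range surfaceGenerator) ≤
        surfaceSubgroup339.comap surfaceGroupHom := by
      rw [Subgroup.closure_le]
      rintro _ ⟨y, rfl⟩
      change surfaceGroupHom (surfaceGenerator y) ∈ surfaceSubgroup339
      rw [surfaceGroupHom_generator]
      have m := pairingElement339_mem
      obtain ⟨i, b⟩ := y
      fin_cases i <;> cases b
      · exact m 0
      · exact m 1
      · exact mul_mem (mul_mem (m 1) (inv_mem (m 5))) (inv_mem (m 1))
      · exact mul_mem (inv_mem (m 2)) (inv_mem (m 1))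
    exact hle hx
  · rw [surfaceSubgroup339, Subgroup.closure_le]
    rintro _ ⟨k, rfl⟩
    rw [pairingElement339_eq_surfacePairing]
    simp only [← surfaceGroupHom_generator]
    rw [← map_surfacePairing]
    exact ⟨_, rfl⟩

/-- On the labels over the first triangle, the surface group acts by left translation. Evaluating at
`y = 1` therefore recovers `x` from its image, which gives injectivity. -/
theorem pairingAction_surfaceGroupHom (x y : SurfaceGroup 2) :
    pairingAction isPairingFamily_surfaceGenerator (surfaceGroupHom x) (0, y) = (0, x * y) := by
  have A := pairingAction_pairingElement isPairingFamily_surfaceGenerator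
  let K : Subgroup (SurfaceGroup 2) :=
    { carrier := {x | ∀ y, pairingAction isPairingFamily_surfaceGenerator (surfaceGroupHom x)
        (0, y) = (0, x * y)}
      one_mem' := by intro y; simp
      mul_mem' := by
        intro a b ha hb y
        rw [map_mul, map_mul, Equiv.Perm.mul_apply, hb, ha, mul_assoc]
      inv_mem' := by
        intro a ha y
        rw [map_inv, map_inv, Equiv.Perm.inv_eq_iff_eq, ha, mul_inv_cancel_left] }
  have memK : ∀ z, (∀ y, pairingAction isPairingFamily_surfaceGenerator (surfaceGroupHom z)
        (0, y) = (0, z * y)) → z ∈ K := fun z hz => hz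
  have hK : K = ⊤ := by
    rw [eq_top_iff, ← PresentedGroup.closure_range_of, Subgroup.closure_le]
    have K0 : surfaceGenerator (0, false) ∈ K := memK _ fun y => by
      rw [surfaceGroupHom_generator]; exact A 0 y
    have K1 : surfaceGenerator (0, true) ∈ K := memK _ fun y => by
      rw [surfaceGroupHom_generator]; exact A 1 y
    have Ainv : ∀ k y, pairingAction isPairingFamily_surfaceGenerator (pairingElement339 k)⁻¹
        (0, y) = (0, (surfacePairing (surfaceGenerator (0, false)) (surfaceGenerator (0, true))
          (surfaceGenerator (1, false)) (surfaceGenerator (1, true)) k)⁻¹ * y) := by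
      intro k y
      rw [map_inv, Equiv.Perm.inv_eq_iff_eq, A, mul_inv_cancel_left]
    have K2 : surfaceGenerator (1, false) ∈ K := memK _ fun y => by
      rw [surfaceGroupHom_generator, surfaceGeneratorImage, map_mul, map_mul,
        Equiv.Perm.mul_apply, Equiv.Perm.mul_apply, Ainv, Ainv, A]
      simp [surfacePairing, mul_assoc]
    have K3 : surfaceGenerator (1, true) ∈ K := memK _ fun y => by
      rw [surfaceGroupHom_generator, surfaceGeneratorImage, map_mul,
        Equiv.Perm.mul_apply, Ainv, Ainv]
      simp [surfacePairing, mul_assoc]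
    rintro _ ⟨⟨i, b⟩, rfl⟩
    fin_cases i <;> cases b
    exacts [K0, K1, K2, K3]
  have : x ∈ K := hK ▸ trivial
  exact this y

theorem surfaceGroupHom_injective : Function.Injective surfaceGroupHom := by
  rw [injective_iff_map_eq_one]
  intro x hx
  have := pairingAction_surfaceGroupHom x 1
  rw [hx, map_one] at this
  simpa using (congrArg Prod.snd this).symm

theorem nonempty_surfaceSubgroup339_mulEquiv :
    Nonempty (surfaceSubgroup339 ≃* SurfaceGroup 2) :=
  ⟨((MulEquiv.subgroupCongr surfaceGroupHom_range.symm).trans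
    (MonoidHom.ofInjective surfaceGroupHom_injective).symm)⟩

end SurfaceGroup

/-! ## The hyperboloid model

The vectors of signature `(2, 1)` are symmetric `2 × 2` matrices, and the point `x + iy` of the upper
half-plane is the matrix with entries `1/y`, `x/y`, `(x² + y²)/y`. -/

/-- The Lorentz form on the space of symmetric `2 × 2` matrices. -/
noncomputable def lorentz (u v : Fin 3 → ℝ) : ℝ := u 1 * v 1 - (u 0 * v 2 + u 2 * v 0) / 2

/-- The point of the hyperboloid which corresponds to a point of the upper half-plane. -/
noncomputable def hyperboloidPoint (z : ℍ) : Fin 3 → ℝ :=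
  ![1 / z.im, z.re / z.im, (z.re ^ 2 + z.im ^ 2) / z.im]

/-- The tangent vector `α E₁ + β E₂` at `z`, for the orthonormal frame `E₁ = y ∂_x`, `E₂ = y ∂_y`. -/
noncomputable def frameVector (z : ℍ) (α β : ℝ) : Fin 3 → ℝ :=
  ![-β / z.im, α - β * z.re / z.im, 2 * α * z.re + β * (z.im - z.re ^ 2 / z.im)]

theorem lorentz_comm (u v : Fin 3 → ℝ) : lorentz u v = lorentz v u := by
  simp only [lorentz]; ring

theorem lorentz_add_left (u v w : Fin 3 → ℝ) : lorentz (u + v) w = lorentz u w + lorentz v w := by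
  simp only [lorentz, Pi.add_apply]; ring

theorem lorentz_add_right (u v w : Fin 3 → ℝ) : lorentz u (v + w) = lorentz u v + lorentz u w := by
  simp only [lorentz, Pi.add_apply]; ring

theorem lorentz_sub_left (u v w : Fin 3 → ℝ) : lorentz (u - v) w = lorentz u w - lorentz v w := by
  simp only [lorentz, Pi.sub_apply]; ring

theorem lorentz_smul_left (c : ℝ) (u v : Fin 3 → ℝ) : lorentz (c • u) v = c * lorentz u v := by
  simp only [lorentz, Pi.smul_apply, smul_eq_mul]; ring

theorem lorentz_smul_right (c : ℝ) (u v : Fin 3 → ℝ) : lorentz u (c • v) = c * lorentz u v := by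
  simp only [lorentz, Pi.smul_apply, smul_eq_mul]; ring

theorem lorentz_neg_left (u v : Fin 3 → ℝ) : lorentz (-u) v = -lorentz u v := by
  simp only [lorentz, Pi.neg_apply]; ring

theorem lorentz_neg_right (u v : Fin 3 → ℝ) : lorentz u (-v) = -lorentz u v := by
  simp only [lorentz, Pi.neg_apply]; ring

theorem lorentz_hyperboloidPoint (z w : ℍ) :
    lorentz (hyperboloidPoint z) (hyperboloidPoint w) = -Real.cosh (dist z w) := by
  rw [UpperHalfPlane.cosh_dist']
  simp [lorentz, hyperboloidPoint]
  field_simp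
  ring

theorem lorentz_hyperboloidPoint_self (z : ℍ) :
    lorentz (hyperboloidPoint z) (hyperboloidPoint z) = -1 := by
  rw [lorentz_hyperboloidPoint, dist_self, Real.cosh_zero]

theorem lorentz_hyperboloidPoint_frameVector (z : ℍ) (α β : ℝ) :
    lorentz (hyperboloidPoint z) (frameVector z α β) = 0 := by
  simp [lorentz, hyperboloidPoint, frameVector]
  field_simp
  ring

theorem lorentz_frameVector (z : ℍ) (α β α' β' : ℝ) :
    lorentz (frameVector z α β) (frameVector z α' β') = α * α' + β * β' := by
  simp [lorentz, frameVector]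
  field_simp
  ring

theorem frameVector_smul (z : ℍ) (c α β : ℝ) :
    c • frameVector z α β = frameVector z (c * α) (c * β) := by
  ext i; fin_cases i <;> simp [frameVector] <;> ring

theorem eq_hyperboloidPoint_add_frameVector (z : ℍ) (v : Fin 3 → ℝ) :
    v = -lorentz v (hyperboloidPoint z) • hyperboloidPoint z +
      frameVector z (lorentz v (frameVector z 1 0)) (lorentz v (frameVector z 0 1)) := by
  ext i; fin_cases i <;> simp [lorentz, frameVector, hyperboloidPoint] <;> field_simp <;> ring

theorem exists_eq_frameVector {z : ℍ} {v : Fin 3 → ℝ}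
    (h : lorentz v (hyperboloidPoint z) = 0) : ∃ α β, v = frameVector z α β := by
  have := eq_hyperboloidPoint_add_frameVector z v
  rw [h] at this
  exact ⟨_, _, by simpa using this⟩

theorem hyperboloidPoint_injective : Function.Injective hyperboloidPoint := by
  intro z w h
  have hw := w.im_ne_zero
  have h0 := congrFun h 0
  have h1 := congrFun h 1
  simp [hyperboloidPoint] at h0 h1
  rw [h0, div_left_inj' hw] at h1
  exact UpperHalfPlane.ext_re_im h1 h0

theorem exists_hyperboloidPoint_eq {q : Fin 3 → ℝ} (hq : lorentz q q = -1) (h0 : 0 < q 0) :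
    ∃ z, hyperboloidPoint z = q := by
  refine ⟨⟨⟨q 1 / q 0, 1 / q 0⟩, by positivity⟩, ?_⟩
  have : q 1 ^ 2 + 1 = q 0 * q 2 := by
    simp only [lorentz] at hq; linarith
  ext i
  fin_cases i
  · simp [hyperboloidPoint, UpperHalfPlane.im]
  · simp [hyperboloidPoint, UpperHalfPlane.im, UpperHalfPlane.re]
    field_simp
  · simp [hyperboloidPoint, UpperHalfPlane.im, UpperHalfPlane.re]
    field_simp
    linarith

/-! ### Geodesics -/

theorem cosh_sub_mul_sinh_pos {β : ℝ} (hβ : β ^ 2 ≤ 1) (t : ℝ) :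
    0 < Real.cosh t - β * Real.sinh t := by
  rw [Real.cosh_eq, Real.sinh_eq]
  have e1 := Real.exp_pos t
  have e2 := Real.exp_pos (-t)
  rcases le_total β 0 with h | h <;> nlinarith

/-- Distances determine all Lorentz products along the curve. In the frame at `γ 0` the tangential
part `(a t, b t)` has Euclidean products `sinh s * sinh t`, so the equality case of Cauchy–Schwarz
makes it `sinh t` times a fixed unit vector. -/
theorem Isometry.exists_hyperboloidPoint_eq {γ : ℝ → ℍ} (hγ : Isometry γ) :
    ∃ α β : ℝ, α ^ 2 + β ^ 2 = 1 ∧ ∀ t, hyperboloidPoint (γ t) =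
      Real.cosh t • hyperboloidPoint (γ 0) + Real.sinh t • frameVector (γ 0) α β := by
  have hG : ∀ s t, lorentz (hyperboloidPoint (γ s)) (hyperboloidPoint (γ t)) =
      -Real.cosh (s - t) := by
    intro s t
    rw [lorentz_hyperboloidPoint, hγ.dist_eq, Real.dist_eq, Real.cosh_abs]
  set a : ℝ → ℝ := fun t => lorentz (hyperboloidPoint (γ t)) (frameVector (γ 0) 1 0) with ha
  set b : ℝ → ℝ := fun t => lorentz (hyperboloidPoint (γ t)) (frameVector (γ 0) 0 1) with hb
  have hq : ∀ t, hyperboloidPoint (γ t) =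
      Real.cosh t • hyperboloidPoint (γ 0) + frameVector (γ 0) (a t) (b t) := by
    intro t
    have := eq_hyperboloidPoint_add_frameVector (γ 0) (hyperboloidPoint (γ t))
    rwa [hG, sub_zero, neg_neg] at this
  have hab : ∀ s t, a s * a t + b s * b t = Real.sinh s * Real.sinh t := by
    intro s t
    have h := hG s t
    rw [hq s, hq t, lorentz_add_left, lorentz_add_right, lorentz_add_right, lorentz_smul_left,
      lorentz_smul_left, lorentz_smul_right, lorentz_smul_right, lorentz_frameVector,
      lorentz_hyperboloidPoint_self, lorentz_comm (frameVector _ _ _),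
      lorentz_hyperboloidPoint_frameVector, lorentz_hyperboloidPoint_frameVector,
      Real.cosh_sub] at h
    linarith
  refine ⟨a 1 / Real.sinh 1, b 1 / Real.sinh 1, ?_, ?_⟩
  · have := hab 1 1
    field_simp
    linarith
  · intro t
    rw [hq t, frameVector_smul]
    have e11 := hab 1 1
    have et1 := hab t 1
    have ett := hab t t
    -- This is the squared distance between `(a t, b t)` and its predicted value, expanded with the
    -- three products above.
    have hz : (a t - Real.sinh t * (a 1 / Real.sinh 1)) ^ 2 +
        (b t - Real.sinh t * (b 1 / Real.sinh 1)) ^ 2 = 0 := by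
      have : (a t - Real.sinh t * (a 1 / Real.sinh 1)) ^ 2 +
        (b t - Real.sinh t * (b 1 / Real.sinh 1)) ^ 2 = (a t * a t + b t * b t) -
          2 * (Real.sinh t / Real.sinh 1) * (a t * a 1 + b t * b 1) +
          (Real.sinh t / Real.sinh 1) ^ 2 * (a 1 * a 1 + b 1 * b 1) := by
        field_simp; ring
      rw [this, e11, et1, ett]
      field_simp
      ring
    have e1 : a t = Real.sinh t * (a 1 / Real.sinh 1) := by
      nlinarith [sq_nonneg (a t - Real.sinh t * (a 1 / Real.sinh 1)),
        sq_nonneg (b t - Real.sinh t * (b 1 / Real.sinh 1))]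
    have e2 : b t = Real.sinh t * (b 1 / Real.sinh 1) := by
      nlinarith [sq_nonneg (a t - Real.sinh t * (a 1 / Real.sinh 1)),
        sq_nonneg (b t - Real.sinh t * (b 1 / Real.sinh 1))]
    rw [← e1, ← e2]

/-- Solving the hyperboloid formula for real and imaginary parts and differentiating shows that `(α,
β)` is the Euclidean velocity divided by the height. Angles can thus be read in the Lorentz form. -/
theorem deriv_coe_eq {γ : ℝ → ℍ} {α β : ℝ} (hαβ : α ^ 2 + β ^ 2 = 1)
    (h : ∀ t, hyperboloidPoint (γ t) =
      Real.cosh t • hyperboloidPoint (γ 0) + Real.sinh t • frameVector (γ 0) α β) :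
    deriv (fun t => (γ t : ℂ)) 0 = (γ 0).im * (α + β * Complex.I) := by
  set x := (γ 0).re with hx
  set y := (γ 0).im with hy
  have hy0 : y ≠ 0 := (γ 0).im_ne_zero
  have hpos : ∀ t, Real.cosh t - β * Real.sinh t ≠ 0 := fun t =>
    (cosh_sub_mul_sinh_pos (by nlinarith [sq_nonneg α]) t).ne'
  have him : ∀ t, (γ t).im = y / (Real.cosh t - β * Real.sinh t) := by
    intro t
    have h0 := congrFun (h t) 0
    have ht := (γ t).im_ne_zero
    simp [hyperboloidPoint, frameVector, ← hx, ← hy] at h0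
    have h0' : (γ t).im⁻¹ = (Real.cosh t - β * Real.sinh t) / y := by rw [h0]; ring
    rw [← inv_inv (γ t).im, h0', inv_div]
  have hre : ∀ t, (γ t).re = x + y * α * Real.sinh t / (Real.cosh t - β * Real.sinh t) := by
    intro t
    have h1 := congrFun (h t) 1
    have ht := (γ t).im_ne_zero
    have hp := hpos t
    simp [hyperboloidPoint, frameVector, ← hx, ← hy] at h1
    rw [div_eq_iff ht, him] at h1
    rw [h1]
    generalize hD : Real.cosh t - β * Real.sinh t = D at hp ⊢
    have hc : Real.cosh t = D + β * Real.sinh t := by linarith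
    rw [hc]
    field_simp
    ring
  have hfun : (fun t => (γ t : ℂ)) = fun t : ℝ =>
      (((x + y * α * Real.sinh t / (Real.cosh t - β * Real.sinh t) : ℝ) : ℂ) +
        ((y / (Real.cosh t - β * Real.sinh t) : ℝ) : ℂ) * Complex.I) := by
    funext t
    rw [← hre, ← him, UpperHalfPlane.re_add_im]
  have hd : HasDerivAt (fun t => Real.cosh t - β * Real.sinh t)
      (Real.sinh 0 - β * Real.cosh 0) 0 :=
    (Real.hasDerivAt_cosh 0).sub ((Real.hasDerivAt_sinh 0).const_mul β)
  have h1 := (((Real.hasDerivAt_sinh 0).const_mul (y * α)).div hd (hpos 0)).const_add x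
  have h2 := ((hasDerivAt_const (0 : ℝ) y).div hd (hpos 0))
  have h3 := h1.ofReal_comp.add (h2.ofReal_comp.mul_const Complex.I)
  rw [hfun]
  refine (h3.congr_deriv ?_).deriv
  simp
  ring

/-! ### Unit normals and reflections -/

/-- The vector `v` is a unit normal vector of the geodesic `L`. -/
def IsUnitNormal (L : Set ℍ) (v : Fin 3 → ℝ) : Prop :=
  lorentz v v = 1 ∧ ∀ z ∈ L, lorentz v (hyperboloidPoint z) = 0

theorem IsUnitNormal.neg {L : Set ℍ} {v : Fin 3 → ℝ} (hv : IsUnitNormal L v) :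
    IsUnitNormal L (-v) :=
  ⟨by rw [lorentz_neg_left, lorentz_neg_right, neg_neg]; exact hv.1,
    fun z hz => by rw [lorentz_neg_left, hv.2 z hz, neg_zero]⟩

theorem isUnitNormal_frameVector {γ : ℝ → ℍ} {α β : ℝ} (hαβ : α ^ 2 + β ^ 2 = 1)
    (h : ∀ t, hyperboloidPoint (γ t) =
      Real.cosh t • hyperboloidPoint (γ 0) + Real.sinh t • frameVector (γ 0) α β) :
    IsUnitNormal (Set.range γ) (frameVector (γ 0) (-β) α) := by
  constructor
  · rw [lorentz_frameVector]; linarith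
  · rintro _ ⟨t, rfl⟩
    rw [h, lorentz_add_right, lorentz_smul_right, lorentz_smul_right, lorentz_frameVector,
      lorentz_comm, lorentz_hyperboloidPoint_frameVector]
    ring

/-- The vectors which are orthogonal to a geodesic are the multiples of its unit normal vector. -/
theorem IsUnitNormal.eq_smul {γ : ℝ → ℍ} (hγ : Isometry γ) {v : Fin 3 → ℝ}
    (hv : IsUnitNormal (Set.range γ) v) {d : Fin 3 → ℝ}
    (hd : ∀ z ∈ Set.range γ, lorentz d (hyperboloidPoint z) = 0) : d = lorentz d v • v := by
  obtain ⟨α, β, hαβ, h⟩ := hγ.exists_hyperboloidPoint_eq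
  have perp : ∀ w : Fin 3 → ℝ, (∀ z ∈ Set.range γ, lorentz w (hyperboloidPoint z) = 0) →
      ∃ a b, w = frameVector (γ 0) a b ∧ a * α + b * β = 0 := by
    intro w hw
    obtain ⟨a, b, rfl⟩ := exists_eq_frameVector (hw _ ⟨0, rfl⟩)
    refine ⟨a, b, rfl, ?_⟩
    have h1 := hw _ ⟨1, rfl⟩
    rw [h, lorentz_add_right, lorentz_smul_right, lorentz_smul_right, lorentz_frameVector,
      lorentz_comm, lorentz_hyperboloidPoint_frameVector, mul_zero, zero_add] at h1
    rcases mul_eq_zero.1 h1 with h1 | h1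
    · rw [Real.sinh_eq_zero] at h1; norm_num at h1
    · exact h1
  obtain ⟨a, b, rfl, hab⟩ := perp d hd
  obtain ⟨a', b', rfl, hab'⟩ := perp v hv.2
  have hn := hv.1
  rw [lorentz_frameVector] at hn
  rw [lorentz_frameVector, frameVector_smul]
  have hz : a * b' - b * a' = 0 := by
    linear_combination (α * b' - β * a') * hab - (α * b - β * a) * hab' - (a * b' - b * a') * hαβ
  congr 1
  · linear_combination (-a) * hn + b' * hz
  · linear_combination (-b) * hn - a' * hz

/-- As `I` fixes the geodesic pointwise, `z` and `I z` are equidistant from each of its points, so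
their difference is `c • v`. The norm condition leaves `c = 0` or the reflection coefficient; if `c
= 0` then `z` lies on the geodesic, where the two agree. -/
theorem IsInversionIn.hyperboloidPoint_apply {I : ℍ ≃ᵢ ℍ} {γ : ℝ → ℍ} (hγ : Isometry γ)
    (hI : IsInversionIn I (Set.range γ)) {v : Fin 3 → ℝ} (hv : IsUnitNormal (Set.range γ) v)
    (z : ℍ) : hyperboloidPoint (I z) =
      hyperboloidPoint z - (2 * lorentz (hyperboloidPoint z) v) • v := by
  have hfix : ∀ w ∈ Set.range γ, I w = w := fun w hw => by
    have : w ∈ {z : ℍ | I z = z} := by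
      rw [hI]; exact hw
    exact this
  have hd := hv.eq_smul hγ (d := hyperboloidPoint (I z) - hyperboloidPoint z) (fun w hw => by
    rw [lorentz_sub_left, lorentz_hyperboloidPoint, lorentz_hyperboloidPoint]
    nth_rw 1 [← hfix w hw]
    rw [I.dist_eq, sub_self])
  set c := lorentz (hyperboloidPoint (I z) - hyperboloidPoint z) v with hc
  have he : hyperboloidPoint (I z) = hyperboloidPoint z + c • v := by
    rw [← hd]; abel
  have hn := lorentz_hyperboloidPoint_self (I z)
  rw [he, lorentz_add_left, lorentz_add_right, lorentz_add_right, lorentz_smul_left,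
    lorentz_smul_left, lorentz_smul_right, lorentz_smul_right, lorentz_hyperboloidPoint_self,
    lorentz_comm v, hv.1] at hn
  have hc0 : c * (c + 2 * lorentz (hyperboloidPoint z) v) = 0 := by linarith
  rcases mul_eq_zero.1 hc0 with h0 | h0
  · have hz : I z = z := hyperboloidPoint_injective (by rw [he, h0]; simp)
    have hz' : z ∈ Set.range γ := by
      rw [← hI]; exact hz
    rw [hz, lorentz_comm, hv.2 z hz']
    simp
  · rw [he, eq_neg_of_add_eq_zero_left h0, neg_smul, sub_eq_add_neg]

theorem MeetAtAngle.exists_isometry {L L' : Set ℍ} {θ : ℝ} (h : MeetAtAngle L L' θ) :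
    (∃ γ : ℝ → ℍ, Isometry γ ∧ Set.range γ = L) ∧ ∃ γ : ℝ → ℍ, Isometry γ ∧ Set.range γ = L' := by
  obtain ⟨γ, δ, hγ, hδ, h1, h2, -⟩ := h
  exact ⟨⟨γ, hγ, h1⟩, ⟨δ, hδ, h2⟩⟩

theorem exists_isUnitNormal {γ : ℝ → ℍ} (hγ : Isometry γ) : ∃ v, IsUnitNormal (Set.range γ) v := by
  obtain ⟨α, β, hαβ, h⟩ := hγ.exists_hyperboloidPoint_eq
  exact ⟨_, isUnitNormal_frameVector hαβ h⟩

theorem IsUnitNormal.eq_or_eq_neg {γ : ℝ → ℍ} (hγ : Isometry γ) {v w : Fin 3 → ℝ}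
    (hv : IsUnitNormal (Set.range γ) v) (hw : IsUnitNormal (Set.range γ) w) :
    w = v ∨ w = -v := by
  have h := hv.eq_smul hγ hw.2
  have hn := hw.1
  rw [h, lorentz_smul_left, lorentz_smul_right, hv.1, mul_one] at hn
  rcases mul_self_eq_one_iff.1 hn with h1 | h1
  · left; rw [h, h1, one_smul]
  · right; rw [h, h1, neg_one_smul]

theorem MeetAtAngle.lorentz_eq {L L' : Set ℍ} {θ : ℝ} (h : MeetAtAngle L L' θ)
    {v v' : Fin 3 → ℝ} (hv : IsUnitNormal L v) (hv' : IsUnitNormal L' v') :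
    lorentz v v' = Real.cos θ ∨ lorentz v v' = -Real.cos θ := by
  obtain ⟨γ, δ, hγ, hδ, rfl, rfl, h0, ha⟩ := h
  obtain ⟨α, β, hαβ, h⟩ := hγ.exists_hyperboloidPoint_eq
  obtain ⟨α', β', hαβ', h'⟩ := hδ.exists_hyperboloidPoint_eq
  have hcos : α * α' + β * β' = Real.cos θ := by
    rw [← ha, InnerProductGeometry.cos_angle, deriv_coe_eq hαβ h, deriv_coe_eq hαβ' h', h0]
    have hy := (δ 0).im_pos
    have hn : ∀ a b : ℝ, a ^ 2 + b ^ 2 = 1 → ‖((δ 0).im * (a + b * Complex.I) : ℂ)‖ = (δ 0).im := by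
      intro a b hab
      rw [norm_mul, Complex.norm_add_mul_I, hab, Real.sqrt_one, mul_one, Complex.norm_real,
        Real.norm_of_nonneg hy.le]
    rw [hn _ _ hαβ, hn _ _ hαβ', Complex.inner]
    simp
    field_simp
  have n := isUnitNormal_frameVector hαβ h
  have n' := isUnitNormal_frameVector hαβ' h'
  have e : lorentz (frameVector (γ 0) (-β) α) (frameVector (δ 0) (-β') α') = Real.cos θ := by
    rw [h0, lorentz_frameVector, ← hcos]; ring
  rcases n.eq_or_eq_neg hγ hv with rfl | rfl <;> rcases n'.eq_or_eq_neg hδ hv' with rfl | rfl <;>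
    simp [lorentz_neg_left, lorentz_neg_right, e]

/-! ### The triangle -/

/-- The form has signature `(2, 1)`, so a Gram determinant is a negative multiple of the square of a
determinant. This sign selects the consistent orientation of the three normals. -/
theorem lorentz_gram (u v w : Fin 3 → ℝ) :
    lorentz u u * lorentz v v * lorentz w w + 2 * (lorentz u v * lorentz v w * lorentz u w) -
      lorentz u u * lorentz v w ^ 2 - lorentz v v * lorentz u w ^ 2 - lorentz w w * lorentz u v ^ 2 =
    -(Matrix.det !![u 0, u 1, u 2; v 0, v 1, v 2; w 0, w 1, w 2]) ^ 2 / 4 := by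
  simp only [lorentz, Matrix.det_fin_three]
  simp
  ring

theorem eq_zero_of_lorentz_eq_zero {u v w d : Fin 3 → ℝ}
    (h : Matrix.det !![u 0, u 1, u 2; v 0, v 1, v 2; w 0, w 1, w 2] ≠ 0)
    (hu : lorentz d u = 0) (hv : lorentz d v = 0) (hw : lorentz d w = 0) : d = 0 := by
  have := Matrix.eq_zero_of_mulVec_eq_zero h (v := ![-d 2 / 2, d 1, -d 0 / 2]) (by
    simp only [lorentz] at hu hv hw
    ext i
    fin_cases i <;> simp [Matrix.mulVec, dotProduct, Fin.sum_univ_three] <;> linarith)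
  have h0 := congrFun this 0
  have h1 := congrFun this 1
  have h2 := congrFun this 2
  simp at h0 h1 h2
  ext i
  fin_cases i <;> simp [h0, h1, h2]

theorem half_lt_cos_pi_div_nine : 1 / 2 < Real.cos (Real.pi / 9) := by
  rw [← Real.cos_pi_div_three]
  apply Real.cos_lt_cos_of_nonneg_of_le_pi <;> linarith [Real.pi_pos]

theorem cos_pi_div_nine_lt_one : Real.cos (Real.pi / 9) < 1 := by
  rw [← Real.cos_zero]
  apply Real.cos_lt_cos_of_nonneg_of_le_pi <;> linarith [Real.pi_pos]

theorem four_mul_cos_pi_div_nine_cube :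
    8 * Real.cos (Real.pi / 9) ^ 3 = 6 * Real.cos (Real.pi / 9) + 1 := by
  have := Real.cos_three_mul (Real.pi / 9)
  rw [show 3 * (Real.pi / 9) = Real.pi / 3 by ring, Real.cos_pi_div_three] at this
  linarith

/-- Unit normal vectors of the sides of a triangle with angles `π/3`, `π/3`, `π/9`, which point
inwards. -/
structure IsTriangleNormals (v₁ v₂ v₃ : Fin 3 → ℝ) : Prop where
  self₁ : lorentz v₁ v₁ = 1
  self₂ : lorentz v₂ v₂ = 1
  self₃ : lorentz v₃ v₃ = 1
  inner₁₂ : lorentz v₁ v₂ = -Real.cos (Real.pi / 9)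
  inner₁₃ : lorentz v₁ v₃ = -(1 / 2)
  inner₂₃ : lorentz v₂ v₃ = -(1 / 2)

theorem exists_isTriangleNormals {L₁ L₂ L₃ : Set ℍ} (h₂₃ : MeetAtAngle L₂ L₃ (Real.pi / 3))
    (h₁₃ : MeetAtAngle L₁ L₃ (Real.pi / 3)) (h₁₂ : MeetAtAngle L₁ L₂ (Real.pi / 9)) :
    ∃ v₁ v₂ v₃, IsUnitNormal L₁ v₁ ∧ IsUnitNormal L₂ v₂ ∧ IsUnitNormal L₃ v₃ ∧
      IsTriangleNormals v₁ v₂ v₃ := by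
  obtain ⟨⟨γ₁, hγ₁, e₁⟩, ⟨γ₂, hγ₂, e₂⟩⟩ := h₁₂.exists_isometry
  obtain ⟨-, ⟨γ₃, hγ₃, e₃⟩⟩ := h₁₃.exists_isometry
  obtain ⟨n₁, hn₁⟩ := exists_isUnitNormal hγ₁
  obtain ⟨n₂, hn₂⟩ := exists_isUnitNormal hγ₂
  obtain ⟨v₃, hv₃⟩ := exists_isUnitNormal hγ₃
  rw [e₁] at hn₁
  rw [e₂] at hn₂
  rw [e₃] at hv₃
  have flip : ∀ (L : Set ℍ) (n : Fin 3 → ℝ), IsUnitNormal L n → MeetAtAngle L L₃ (Real.pi / 3) →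
      ∃ v, IsUnitNormal L v ∧ lorentz v v₃ = -(1 / 2) := by
    intro L n hn hm
    rcases hm.lorentz_eq hn hv₃ with h | h <;> rw [Real.cos_pi_div_three] at h
    · exact ⟨-n, hn.neg, by rw [lorentz_neg_left, h]⟩
    · exact ⟨n, hn, h⟩
  obtain ⟨v₁, hv₁, i₁₃⟩ := flip _ n₁ hn₁ h₁₃
  obtain ⟨v₂, hv₂, i₂₃⟩ := flip _ n₂ hn₂ h₂₃
  refine ⟨v₁, v₂, v₃, hv₁, hv₂, hv₃, hv₁.1, hv₂.1, hv₃.1, ?_, i₁₃, i₂₃⟩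
  rcases h₁₂.lorentz_eq hv₁ hv₂ with h | h
  · exfalso
    -- With `c = cos (π/9)`, the wrong sign would give the Gram determinant `(1 - c)(c + 1/2) > 0`,
    -- which the signature forbids.
    have := lorentz_gram v₁ v₂ v₃
    rw [hv₁.1, hv₂.1, hv₃.1, h, i₁₃, i₂₃] at this
    have c1 := half_lt_cos_pi_div_nine
    have c2 := cos_pi_div_nine_lt_one
    nlinarith [sq_nonneg (Matrix.det !![v₁ 0, v₁ 1, v₁ 2; v₂ 0, v₂ 1, v₂ 2; v₃ 0, v₃ 1, v₃ 2])]
  · exact h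

theorem IsTriangleNormals.neg {v₁ v₂ v₃ : Fin 3 → ℝ} (h : IsTriangleNormals v₁ v₂ v₃) :
    IsTriangleNormals (-v₁) (-v₂) (-v₃) := by
  obtain ⟨h1, h2, h3, h4, h5, h6⟩ := h
  constructor <;> rw [lorentz_neg_left, lorentz_neg_right, neg_neg] <;> assumption

theorem IsTriangleNormals.det_ne_zero {v₁ v₂ v₃ : Fin 3 → ℝ} (h : IsTriangleNormals v₁ v₂ v₃) :
    Matrix.det !![v₁ 0, v₁ 1, v₁ 2; v₂ 0, v₂ 1, v₂ 2; v₃ 0, v₃ 1, v₃ 2] ≠ 0 := by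
  intro h0
  have := lorentz_gram v₁ v₂ v₃
  rw [h.self₁, h.self₂, h.self₃, h.inner₁₂, h.inner₁₃, h.inner₂₃, h0] at this
  have c1 := half_lt_cos_pi_div_nine
  nlinarith

theorem exists_isometry_of_lorentz {p u : Fin 3 → ℝ} (hp : lorentz p p = -1)
    (hu : lorentz u u = 1) (hpu : lorentz p u = 0) (h0 : 0 < p 0) :
    ∃ η : ℝ → ℍ, Isometry η ∧ ∀ t, hyperboloidPoint (η t) = Real.cosh t • p + Real.sinh t • u := by
  obtain ⟨z, rfl⟩ := exists_hyperboloidPoint_eq hp h0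
  rw [lorentz_comm] at hpu
  obtain ⟨α, β, rfl⟩ := exists_eq_frameVector hpu
  rw [lorentz_frameVector] at hu
  have hB : ∀ s t, lorentz (Real.cosh s • hyperboloidPoint z + Real.sinh s • frameVector z α β)
      (Real.cosh t • hyperboloidPoint z + Real.sinh t • frameVector z α β) =
      -Real.cosh (s - t) := by
    intro s t
    rw [lorentz_add_left, lorentz_add_right, lorentz_add_right, lorentz_smul_left,
      lorentz_smul_left, lorentz_smul_left, lorentz_smul_left, lorentz_smul_right,
      lorentz_smul_right, lorentz_smul_right, lorentz_smul_right, lorentz_frameVector, hu,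
      lorentz_hyperboloidPoint_self, hpu, lorentz_hyperboloidPoint_frameVector, Real.cosh_sub]
    ring
  have hex : ∀ t, ∃ w, hyperboloidPoint w =
      Real.cosh t • hyperboloidPoint z + Real.sinh t • frameVector z α β := by
    intro t
    apply exists_hyperboloidPoint_eq
    · rw [hB, sub_self, Real.cosh_zero]
    · have h1 := cosh_sub_mul_sinh_pos (β := β) (by nlinarith [sq_nonneg α]) t
      have hy := z.im_pos
      have : (Real.cosh t • hyperboloidPoint z + Real.sinh t • frameVector z α β) 0 =
          (Real.cosh t - β * Real.sinh t) / z.im := by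
        simp [hyperboloidPoint, frameVector]
        ring
      rw [this]
      positivity
  choose η hη using hex
  refine ⟨η, Isometry.of_dist_eq fun s t => ?_, hη⟩
  have h1 := lorentz_hyperboloidPoint (η s) (η t)
  rw [hη, hη, hB, neg_inj, ← Real.cosh_abs] at h1
  rw [Real.dist_eq]
  exact (Real.cosh_injOn (Set.mem_Ici.2 (abs_nonneg _)) (Set.mem_Ici.2 dist_nonneg) h1).symm

/-- The reflections `I₁, I₂, I₃` in the sides of a triangle with angles `π/3`, `π/3`, `π/9`, in
terms of the signed distances `h i` to the sides (more precisely, of their hyperbolic sines), and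
the common perpendicular `η` of `L₁` and of the image of `L₂` under `I₃`. The distance between
these two lines is `2 * e`. -/
theorem exists_triangle_coordinates {L₁ L₂ L₃ : Set ℍ} {I₁ I₂ I₃ : ℍ ≃ᵢ ℍ}
    (h₂₃ : MeetAtAngle L₂ L₃ (Real.pi / 3)) (h₁₃ : MeetAtAngle L₁ L₃ (Real.pi / 3))
    (h₁₂ : MeetAtAngle L₁ L₂ (Real.pi / 9)) (hI₁ : IsInversionIn I₁ L₁)
    (hI₂ : IsInversionIn I₂ L₂) (hI₃ : IsInversionIn I₃ L₃) :
    ∃ (h : Fin 3 → ℍ → ℝ) (η : ℝ → ℍ) (e : ℝ),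
      (∀ z w, (∀ i, h i z = h i w) → z = w) ∧
      (∀ i j z, h i ((![I₁, I₂, I₃] : Fin 3 → (ℍ ≃ᵢ ℍ)) j z) =
        h i z + 2 * Real.cos (Real.pi / coxeterMatrix339 i j) * h j z) ∧
      0 < e ∧ Real.cosh (2 * e) = Real.cos (Real.pi / 9) + 1 / 2 ∧ Isometry η ∧
      (∀ t, h 0 (η t) = Real.sinh t) ∧
      (∀ t, h 1 (η t) + h 2 (η t) = Real.sinh (2 * e - t)) ∧
      ∀ t, 2 * Real.cosh e * h 2 (η t) = Real.sinh (e - t) := by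
  obtain ⟨v₁, v₂, v₃, hv₁, hv₂, hv₃, hT⟩ := exists_isTriangleNormals h₂₃ h₁₃ h₁₂
  obtain ⟨⟨γ₁, hγ₁, rfl⟩, ⟨γ₂, hγ₂, rfl⟩⟩ := h₁₂.exists_isometry
  obtain ⟨-, ⟨γ₃, hγ₃, rfl⟩⟩ := h₁₃.exists_isometry
  obtain ⟨e, he, hcosh⟩ : ∃ e, 0 < e ∧ Real.cosh (2 * e) = Real.cos (Real.pi / 9) + 1 / 2 := by
    have c1 := half_lt_cos_pi_div_nine
    refine ⟨Real.arcosh (Real.cos (Real.pi / 9) + 1 / 2) / 2, ?_, ?_⟩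
    · have := Real.arcosh_pos (x := Real.cos (Real.pi / 9) + 1 / 2) (by linarith)
      positivity
    · rw [mul_div_cancel₀ _ two_ne_zero, Real.cosh_arcosh (by linarith)]
  set c := Real.cos (Real.pi / 9) with hc
  set C := c + 1 / 2 with hC
  set S := Real.sinh (2 * e) with hS
  have hS0 : 0 < S := Real.sinh_pos_iff.2 (by linarith)
  have hCS : C ^ 2 = S ^ 2 + 1 := by rw [← hcosh, hS, Real.cosh_sq]
  -- The vector `v₂ + v₃` is the image of `v₂` under the reflection in `v₃`, hence a normal of
  -- `I₃L₂`, and its product with `v₁` is `-C = -cosh (2e)`. Removing its `v₁` component and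
  -- normalizing gives, up to sign, the foot on `L₁` of the common perpendicular.
  have hp0 : ∀ v₁ v₂ v₃, IsTriangleNormals v₁ v₂ v₃ →
      lorentz (-(1 / S) • (v₂ + v₃ + C • v₁)) (-(1 / S) • (v₂ + v₃ + C • v₁)) = -1 ∧
      lorentz (-(1 / S) • (v₂ + v₃ + C • v₁)) v₁ = 0 ∧
      lorentz (-(1 / S) • (v₂ + v₃ + C • v₁)) v₂ = (c * C - 1 / 2) / S ∧
      lorentz (-(1 / S) • (v₂ + v₃ + C • v₁)) v₃ = (C - 1) / (2 * S) := by
    intro v₁ v₂ v₃ hT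
    simp only [lorentz_smul_left, lorentz_smul_right, lorentz_add_left, lorentz_add_right]
    rw [lorentz_comm v₃ v₂, lorentz_comm v₃ v₁, lorentz_comm v₂ v₁, hT.self₁, hT.self₂, hT.self₃,
      hT.inner₁₂, hT.inner₁₃, hT.inner₂₃, ← hc]
    refine ⟨?_, ?_, ?_, ?_⟩
    · field_simp
      linear_combination (-2) * hCS + 4 * C * hC
    · field_simp
      linarith
    · field_simp
      ring
    · field_simp
      ring
  -- Negating all three normals at once, if necessary, puts the foot on the upper sheet of the
  -- hyperboloid.
  have main : ∃ v₁ v₂ v₃, IsUnitNormal (Set.range γ₁) v₁ ∧ IsUnitNormal (Set.range γ₂) v₂ ∧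
      IsUnitNormal (Set.range γ₃) v₃ ∧ IsTriangleNormals v₁ v₂ v₃ ∧
      0 < (-(1 / S) • (v₂ + v₃ + C • v₁)) 0 := by
    set p := -(1 / S) • (v₂ + v₃ + C • v₁) with hp
    have hpp := (hp0 _ _ _ hT).1
    rw [← hp] at hpp
    have hne : p 0 ≠ 0 := by
      intro h0
      simp only [lorentz, h0] at hpp
      nlinarith [sq_nonneg (p 1)]
    rcases hne.lt_or_gt with h | h
    · refine ⟨-v₁, -v₂, -v₃, hv₁.neg, hv₂.neg, hv₃.neg, hT.neg, ?_⟩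
      have : -(1 / S) • (-v₂ + -v₃ + C • -v₁) = -p := by
        rw [hp]; module
      rw [this, Pi.neg_apply]
      linarith
    · exact ⟨v₁, v₂, v₃, hv₁, hv₂, hv₃, hT, h⟩
  clear! v₁ v₂ v₃
  obtain ⟨v₁, v₂, v₃, hv₁, hv₂, hv₃, hT, hpos⟩ := main
  obtain ⟨hpp, hp1, hp2, hp3⟩ := hp0 _ _ _ hT
  generalize -(1 / S) • (v₂ + v₃ + C • v₁) = p at hpos hpp hp1 hp2 hp3
  obtain ⟨η, hη, hηt⟩ := exists_isometry_of_lorentz hpp hT.self₁ hp1 hpos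
  refine ⟨fun i z => lorentz (hyperboloidPoint z) (![v₁, v₂, v₃] i), η, e, ?_, ?_, he, hcosh, hη,
    ?_, ?_, ?_⟩
  · intro z w hzw
    apply hyperboloidPoint_injective
    rw [← sub_eq_zero]
    apply eq_zero_of_lorentz_eq_zero hT.det_ne_zero <;> rw [lorentz_sub_left, sub_eq_zero]
    exacts [hzw 0, hzw 1, hzw 2]
  · have g₁₂ : lorentz v₂ v₁ = -c := by rw [lorentz_comm]; exact hT.inner₁₂
    have g₁₃ : lorentz v₃ v₁ = -(1 / 2) := by rw [lorentz_comm]; exact hT.inner₁₃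
    have g₂₃ : lorentz v₃ v₂ = -(1 / 2) := by rw [lorentz_comm]; exact hT.inner₂₃
    have r₁ := hI₁.hyperboloidPoint_apply hγ₁ hv₁
    have r₂ := hI₂.hyperboloidPoint_apply hγ₂ hv₂
    have r₃ := hI₃.hyperboloidPoint_apply hγ₃ hv₃
    intro i j z
    fin_cases i <;> fin_cases j <;>
      simp [r₁, r₂, r₃, lorentz_sub_left, lorentz_smul_left, coxeterMatrix339, hT.self₁, hT.self₂,
        hT.self₃, hT.inner₁₂, hT.inner₁₃, hT.inner₂₃, g₁₂, g₁₃, g₂₃, Real.cos_pi_div_three, ← hc] <;>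
      ring
  · intro t
    change lorentz (hyperboloidPoint (η t)) v₁ = _
    rw [hηt, lorentz_add_left, lorentz_smul_left, lorentz_smul_left, hp1, hT.self₁]
    ring
  · intro t
    change lorentz (hyperboloidPoint (η t)) v₂ + lorentz (hyperboloidPoint (η t)) v₃ = _
    rw [hηt, lorentz_add_left, lorentz_smul_left, lorentz_smul_left, lorentz_add_left,
      lorentz_smul_left, lorentz_smul_left, hp2, hp3, hT.inner₁₂, hT.inner₁₃, Real.sinh_sub,
      ← hS, hcosh, ← hc]
    field_simp
    linear_combination (2 * Real.cosh t) * hCS + (2 * Real.cosh t * C) * hC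
  · intro t
    change 2 * Real.cosh e * lorentz (hyperboloidPoint (η t)) v₃ = _
    have h2 : S = 2 * Real.sinh e * Real.cosh e := Real.sinh_two_mul e
    have h3 : C = 1 + 2 * Real.sinh e ^ 2 := by
      rw [← hcosh, Real.cosh_two_mul, Real.cosh_sq]; ring
    rw [hηt, lorentz_add_left, lorentz_smul_left, lorentz_smul_left, hp3, hT.inner₁₃,
      Real.sinh_sub, h2, h3]
    field_simp
    ring

/-! ## The axis in the tessellation by triangles -/

/-- The parity of the length of an element of the triangle group. -/
noncomputable abbrev parity339 : Coxeter339 →* Multiplicative (ZMod 2) :=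
  coxeterSystem339.lengthParity

theorem parity339_reflection (i : Fin 3) :
    parity339 (reflection339 i) = Multiplicative.ofAdd 1 :=
  coxeterSystem339.lengthParity_simple i

theorem ofAdd_one_ne_one : (Multiplicative.ofAdd 1 : Multiplicative (ZMod 2)) ≠ 1 := by decide

theorem ofAdd_one_mul_self : (Multiplicative.ofAdd 1 : Multiplicative (ZMod 2)) *
    Multiplicative.ofAdd 1 = 1 := by decide

theorem parity339_polygonElement_odd (k : ℤ) : parity339 (polygonElement339 (2 * k + 1)) = 1 := by
  rw [polygonElement339, polygonElement_odd, map_zpow, map_mul, parity339_reflection,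
    parity339_reflection, ofAdd_one_mul_self, one_zpow]

theorem parity339_polygonElement_even (k : ℤ) :
    parity339 (polygonElement339 (2 * k + 2)) = Multiplicative.ofAdd 1 := by
  rw [polygonElement339, polygonElement_even, map_mul, map_zpow, map_mul, parity339_reflection,
    parity339_reflection, ofAdd_one_mul_self, one_zpow, one_mul]

/-- Paired sides have indices of opposite parity, so the polygon elements contribute an odd length,
which the factor `I₃` makes even. -/
theorem parity339_eq_one_of_mem {g : Coxeter339} (hg : g ∈ surfaceSubgroup339) :
    parity339 g = 1 := by
  have hle : surfaceSubgroup339 ≤ parity339.ker := by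
    rw [surfaceSubgroup339, Subgroup.closure_le]
    rintro _ ⟨k, rfl⟩
    change parity339 (pairingElement339 k) = 1
    have key : (∃ a b : ℤ, targetSide k = 2 * a + 1 ∧ sourceSide k = 2 * b + 2) ∨
        ∃ a b : ℤ, targetSide k = 2 * a + 2 ∧ sourceSide k = 2 * b + 1 := by
      fin_cases k
      · exact Or.inr ⟨2, 0, rfl, rfl⟩
      · exact Or.inr ⟨0, 7, rfl, rfl⟩
      · exact Or.inr ⟨3, 1, rfl, rfl⟩
      · exact Or.inl ⟨5, 1, rfl, rfl⟩
      · exact Or.inl ⟨2, 7, rfl, rfl⟩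
      · exact Or.inr ⟨5, 3, rfl, rfl⟩
      · exact Or.inr ⟨6, 4, rfl, rfl⟩
      · exact Or.inl ⟨8, 4, rfl, rfl⟩
      · exact Or.inr ⟨8, 6, rfl, rfl⟩
    rw [pairingElement339, pairingElement, map_mul, map_mul, map_inv, parity339_reflection]
    rcases key with ⟨a, b, ha, hb⟩ | ⟨a, b, ha, hb⟩ <;> rw [ha, hb]
    · rw [parity339_polygonElement_odd, parity339_polygonElement_even, one_mul, mul_inv_cancel]
    · rw [parity339_polygonElement_odd, parity339_polygonElement_even, inv_one, mul_one,
        ofAdd_one_mul_self]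
  exact hle hg

/-- The hyperbolic element `I₁I₃I₂I₃` of the abstract triangle group. -/
noncomputable def axial339 : Coxeter339 :=
  reflection339 0 * reflection339 2 * reflection339 1 * reflection339 2

theorem parity339_axial : parity339 axial339 = 1 := by
  simp only [axial339, map_mul, parity339_reflection]
  decide

/-- The coordinates `h` of a plane on which the triangle group acts, and the axis `η` of
`axial339`, as in `exists_triangle_coordinates`. -/
structure IsFoldedAxis {X : Type*} [MulAction Coxeter339 X] (h : Fin 3 → X → ℝ) (η : ℝ → X)
    (e : ℝ) : Prop where
  root : coxeterSystem339.IsRootFunctions h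
  ext : ∀ z w, (∀ i, h i z = h i w) → z = w
  pos : 0 < e
  cosh_two_mul : Real.cosh (2 * e) = Real.cos (Real.pi / 9) + 1 / 2
  coord₀ : ∀ t, h 0 (η t) = Real.sinh t
  coord₁ : ∀ t, h 1 (η t) + h 2 (η t) = Real.sinh (2 * e - t)
  coord₂ : ∀ t, 2 * Real.cosh e * h 2 (η t) = Real.sinh (e - t)

theorem coxeterMatrix339_ne_zero (i j : Fin 3) : coxeterMatrix339 i j ≠ 0 := by
  fin_cases i <;> fin_cases j <;> simp [coxeterMatrix339]

namespace IsFoldedAxis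

variable {X : Type*} [MulAction Coxeter339 X] {h : Fin 3 → X → ℝ} {η : ℝ → X} {e : ℝ}

theorem refl_zero (H : IsFoldedAxis h η e) (x : X) :
    h 0 (reflection339 0 • x) = -h 0 x ∧
      h 1 (reflection339 0 • x) = h 1 x + 2 * Real.cos (Real.pi / 9) * h 0 x ∧
      h 2 (reflection339 0 • x) = h 2 x + h 0 x := by
  refine ⟨H.root.simple_self 0 x, H.root 1 0 x, ?_⟩
  rw [H.root 2 0 x]
  simp [coxeterMatrix339]

theorem refl_one (H : IsFoldedAxis h η e) (x : X) :
    h 0 (reflection339 1 • x) = h 0 x + 2 * Real.cos (Real.pi / 9) * h 1 x ∧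
      h 1 (reflection339 1 • x) = -h 1 x ∧ h 2 (reflection339 1 • x) = h 2 x + h 1 x := by
  refine ⟨H.root 0 1 x, H.root.simple_self 1 x, ?_⟩
  rw [H.root 2 1 x]
  simp [coxeterMatrix339]

theorem refl_two (H : IsFoldedAxis h η e) (x : X) :
    h 0 (reflection339 2 • x) = h 0 x + h 2 x ∧ h 1 (reflection339 2 • x) = h 1 x + h 2 x ∧
      h 2 (reflection339 2 • x) = -h 2 x := by
  refine ⟨?_, ?_, H.root.simple_self 2 x⟩
  · rw [H.root 0 2 x]; simp [coxeterMatrix339]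
  · rw [H.root 1 2 x]; simp [coxeterMatrix339]

theorem ext_coord (H : IsFoldedAxis h η e) {x y : X} (h₀ : h 0 x = h 0 y)
    (h₁ : h 1 x + h 2 x = h 1 y + h 2 y) (h₂ : h 2 x = h 2 y) : x = y := by
  refine H.ext x y fun i => ?_
  fin_cases i
  · exact h₀
  · change h 1 x = h 1 y
    linarith
  · exact h₂

theorem two_cosh_pos (e : ℝ) : 0 < 2 * Real.cosh e := by
  positivity

theorem reflection_zero_smul (H : IsFoldedAxis h η e) (t : ℝ) :
    reflection339 0 • η t = η (-t) := by
  obtain ⟨r₀, r₁, r₂⟩ := H.refl_zero (η t)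
  have c₂ : h 2 (reflection339 0 • η t) = h 2 (η (-t)) := by
    apply mul_left_cancel₀ (two_cosh_pos e).ne'
    rw [H.coord₂, r₂, mul_add, H.coord₂, H.coord₀, sub_neg_eq_add, Real.sinh_add, Real.sinh_sub]
    ring
  refine H.ext_coord ?_ ?_ c₂
  · rw [r₀, H.coord₀, H.coord₀, Real.sinh_neg]
  · have c₁ := H.coord₁ t
    rw [H.coord₁, r₁, r₂]
    rw [Real.sinh_sub, H.cosh_two_mul] at c₁
    rw [sub_neg_eq_add, Real.sinh_add, H.cosh_two_mul, H.coord₀]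
    linear_combination c₁

/-- The axis meets `I₃L₂` orthogonally at `η (2e)`, so this reflection reverses it about that point.
-/
theorem reflection_conj_smul (H : IsFoldedAxis h η e) (t : ℝ) :
    (reflection339 2 * reflection339 1 * reflection339 2) • η t = η (4 * e - t) := by
  have hx₀ := H.coord₀ t
  have hx₁ := H.coord₁ t
  have hx₂ := H.coord₂ t
  rw [mul_smul, mul_smul]
  obtain ⟨a₀, a₁, a₂⟩ := H.refl_two (η t)
  obtain ⟨b₀, b₁, b₂⟩ := H.refl_one (reflection339 2 • η t)
  obtain ⟨c₀, c₁, c₂⟩ := H.refl_two (reflection339 1 • reflection339 2 • η t)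
  have d₂ : h 2 (reflection339 2 • reflection339 1 • reflection339 2 • η t) =
      h 2 (η (4 * e - t)) := by
    apply mul_left_cancel₀ (two_cosh_pos e).ne'
    rw [H.coord₂, c₂, b₂, a₂, a₁, hx₁]
    have : Real.sinh (e - (4 * e - t)) = Real.sinh (e - t) - 2 * Real.cosh e *
        Real.sinh (2 * e - t) := by
      have key : ∀ u, Real.sinh (-(u + e)) = Real.sinh (u - e) - 2 * Real.cosh e * Real.sinh u := by
        intro u
        rw [Real.sinh_neg, Real.sinh_add, Real.sinh_sub]; ring
      rw [show e - (4 * e - t) = -((2 * e - t) + e) by ring,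
        show e - t = (2 * e - t) - e by ring, key]
    rw [this, ← hx₂]
    ring
  refine H.ext_coord ?_ ?_ d₂
  · rw [c₀, b₀, b₂, a₀, a₁, a₂, hx₁, hx₀, H.coord₀]
    rw [show 4 * e - t = 2 * e + (2 * e - t) by ring, Real.sinh_add]
    have h1 : Real.sinh t = Real.sinh (2 * e - (2 * e - t)) := by ring_nf
    rw [h1, Real.sinh_sub, H.cosh_two_mul]
    ring
  · rw [H.coord₁, c₁, c₂, b₁, b₂, a₁, a₂, hx₁,
      show 2 * e - (4 * e - t) = -(2 * e - t) by ring, Real.sinh_neg]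
    ring

theorem axial_smul (H : IsFoldedAxis h η e) (t : ℝ) : axial339 • η t = η (t - 4 * e) := by
  rw [axial339, mul_assoc, mul_assoc, mul_smul, ← mul_assoc, H.reflection_conj_smul,
    H.reflection_zero_smul]
  ring_nf

theorem axial_zpow_smul (H : IsFoldedAxis h η e) (k : ℤ) (t : ℝ) :
    axial339 ^ k • η t = η (t - 4 * e * k) := by
  induction k using Int.induction_on generalizing t with
  | zero => simp
  | succ k ih =>
    rw [zpow_add_one, mul_smul, H.axial_smul, ih]
    push_cast
    ring_nf
  | pred k ih =>
    have : axial339⁻¹ • η t = η (t + 4 * e) := by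
      rw [inv_smul_eq_iff, H.axial_smul]; ring_nf
    rw [zpow_sub_one, mul_smul, this, ih]
    push_cast
    ring_nf

/-! ### Folding the axis into the triangle -/

theorem coord_one_pos (H : IsFoldedAxis h η e) {τ : ℝ} (h1 : τ ≤ e) : 0 < h 1 (η τ) := by
  have c₁ := H.coord₁ τ
  have c₂ := H.coord₂ τ
  have hp := H.pos
  have hc := Real.one_le_cosh e
  have s1 : 0 ≤ Real.sinh (e - τ) := Real.sinh_nonneg_iff.2 (by linarith)
  have s2 : Real.sinh (e - τ) < Real.sinh (2 * e - τ) := Real.sinh_lt_sinh.2 (by linarith)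
  have : 0 < 2 * Real.cosh e * h 1 (η τ) := by nlinarith
  exact pos_of_mul_pos_right this (two_cosh_pos e).le

theorem coord_zero_pos (H : IsFoldedAxis h η e) {τ : ℝ} (h1 : e ≤ τ) :
    0 < h 0 (reflection339 2 • η τ) := by
  have c₀ := H.coord₀ τ
  have c₂ := H.coord₂ τ
  have hp := H.pos
  have hc := Real.one_le_cosh e
  have s1 : 0 ≤ Real.sinh (τ - e) := Real.sinh_nonneg_iff.2 (by linarith)
  have s2 : Real.sinh (τ - e) < Real.sinh τ := Real.sinh_lt_sinh.2 (by linarith)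
  have s3 : Real.sinh (e - τ) = -Real.sinh (τ - e) := by rw [← Real.sinh_neg]; ring_nf
  rw [(H.refl_two _).1]
  have : 0 < 2 * Real.cosh e * (h 0 (η τ) + h 2 (η τ)) := by nlinarith
  exact pos_of_mul_pos_right this (two_cosh_pos e).le

theorem coord_two_nonneg_iff (H : IsFoldedAxis h η e) {τ : ℝ} : 0 ≤ h 2 (η τ) ↔ τ ≤ e := by
  rw [← mul_nonneg_iff_of_pos_left (two_cosh_pos e), H.coord₂, Real.sinh_nonneg_iff, sub_nonneg]

theorem coord_two_pos_iff (H : IsFoldedAxis h η e) {τ : ℝ} : 0 < h 2 (η τ) ↔ τ < e := by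
  rw [← mul_pos_iff_of_pos_left (two_cosh_pos e), H.coord₂, Real.sinh_pos_iff, sub_pos]

theorem coord_two_eq_zero (H : IsFoldedAxis h η e) : h 2 (η e) = 0 := by
  have := H.coord₂ e
  rw [sub_self, Real.sinh_zero] at this
  exact (mul_eq_zero.1 this).resolve_left (two_cosh_pos e).ne'

theorem reflection_two_smul (H : IsFoldedAxis h η e) : reflection339 2 • η e = η e := by
  obtain ⟨r₀, r₁, r₂⟩ := H.refl_two (η e)
  have := H.coord_two_eq_zero
  refine H.ext_coord ?_ ?_ ?_ <;> linarith

theorem nonneg_of_le (H : IsFoldedAxis h η e) {τ : ℝ} (h0 : 0 ≤ τ) (h1 : τ ≤ e) (i : Fin 3) :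
    0 ≤ h i (η τ) := by
  fin_cases i
  · exact (H.coord₀ τ).symm ▸ Real.sinh_nonneg_iff.2 h0
  · exact (H.coord_one_pos h1).le
  · exact H.coord_two_nonneg_iff.2 h1

theorem nonneg_of_lt (H : IsFoldedAxis h η e) {τ : ℝ} (h1 : e < τ) (h2 : τ ≤ 2 * e) (i : Fin 3) :
    0 ≤ h i (reflection339 2 • η τ) := by
  fin_cases i
  · exact (H.coord_zero_pos h1.le).le
  · change 0 ≤ h 1 _
    rw [(H.refl_two _).2.1, H.coord₁, Real.sinh_nonneg_iff]
    linarith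
  · change 0 ≤ h 2 _
    rw [(H.refl_two _).2.2]
    have := H.coord_two_nonneg_iff (τ := τ)
    by_contra! hc
    exact absurd (this.1 (by linarith)) (by linarith)

/-- For `τ` in `[0, e]` the point lies in the closed chamber and at most one coordinate vanishes
there: `h 0` at `τ = 0` and `h 2` at `τ = e`. The chamber theorems leave only the listed elements.
-/
theorem eq_of_nonneg_of_le (H : IsFoldedAxis h η e) {τ : ℝ} (h0 : 0 ≤ τ) (h1 : τ ≤ e)
    {w : Coxeter339} (hw : ∀ i, 0 ≤ h i (w • η τ)) :
    w • η τ = η τ ∧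
      (w = 1 ∨ (τ = 0 ∧ w = reflection339 0) ∨ (τ = e ∧ w = reflection339 2)) := by
  have p₁ := H.coord_one_pos h1
  have hp := H.pos
  rcases h0.eq_or_lt with rfl | h0
  · have p₂ := H.coord_two_pos_iff.2 hp
    rcases H.root.eq_one_or_eq_simple coxeterMatrix339_ne_zero 0
      (by rw [H.coord₀, Real.sinh_zero])
      (by intro j hj; fin_cases j; exacts [absurd rfl hj, p₁, p₂]) hw with rfl | rfl
    · exact ⟨one_smul _ _, Or.inl rfl⟩
    · exact ⟨(H.reflection_zero_smul 0).trans (by rw [neg_zero]), Or.inr (Or.inl ⟨rfl, rfl⟩)⟩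
  have p₀ : 0 < h 0 (η τ) := (H.coord₀ τ).symm ▸ Real.sinh_pos_iff.2 h0
  rcases h1.eq_or_lt with rfl | h1
  · rcases H.root.eq_one_or_eq_simple coxeterMatrix339_ne_zero 2 H.coord_two_eq_zero
      (by intro j hj; fin_cases j; exacts [p₀, p₁, absurd rfl hj]) hw with rfl | rfl
    · exact ⟨one_smul _ _, Or.inl rfl⟩
    · exact ⟨H.reflection_two_smul, Or.inr (Or.inr ⟨rfl, rfl⟩)⟩
  · have p₂ := H.coord_two_pos_iff.2 h1
    obtain rfl := H.root.eq_one coxeterMatrix339_ne_zero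
      (by intro j; fin_cases j; exacts [p₀, p₁, p₂]) hw
    exact ⟨one_smul _ _, Or.inl rfl⟩

theorem eq_of_nonneg_of_lt (H : IsFoldedAxis h η e) {τ : ℝ} (h1 : e < τ) (h2 : τ ≤ 2 * e)
    {w : Coxeter339} (hw : ∀ i, 0 ≤ h i (w • reflection339 2 • η τ)) :
    w • reflection339 2 • η τ = reflection339 2 • η τ ∧
      (w = 1 ∨ (τ = 2 * e ∧ w = reflection339 1)) := by
  have p₀ := H.coord_zero_pos h1.le
  have p₂ : 0 < h 2 (reflection339 2 • η τ) := by
    rw [(H.refl_two _).2.2]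
    have := H.coord_two_nonneg_iff (τ := τ)
    by_contra! hc
    exact absurd (this.1 (by linarith)) (by linarith)
  have c₁ : h 1 (reflection339 2 • η τ) = Real.sinh (2 * e - τ) := by
    rw [(H.refl_two _).2.1, H.coord₁]
  rcases h2.eq_or_lt with rfl | h2
  · have z₁ : h 1 (reflection339 2 • η (2 * e)) = 0 := by rw [c₁, sub_self, Real.sinh_zero]
    rcases H.root.eq_one_or_eq_simple coxeterMatrix339_ne_zero 1 z₁
      (by intro j hj; fin_cases j; exacts [p₀, absurd rfl hj, p₂]) hw with rfl | rfl
    · exact ⟨one_smul _ _, Or.inl rfl⟩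
    · refine ⟨?_, Or.inr ⟨rfl, rfl⟩⟩
      obtain ⟨r₀, r₁, r₂⟩ := H.refl_one (reflection339 2 • η (2 * e))
      refine H.ext_coord ?_ ?_ ?_
      · rw [r₀, z₁]; ring
      · rw [r₁, r₂, z₁]; ring
      · rw [r₂, z₁]; ring
  · have p₁ : 0 < h 1 (reflection339 2 • η τ) := by
      rw [c₁]; exact Real.sinh_pos_iff.2 (by linarith)
    obtain rfl := H.root.eq_one coxeterMatrix339_ne_zero
      (by intro j; fin_cases j; exacts [p₀, p₁, p₂]) hw
    exact ⟨one_smul _ _, Or.inl rfl⟩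

/-! ### Rigidity of the folded half period -/

theorem injective (H : IsFoldedAxis h η e) {s t : ℝ} (hst : η s = η t) : s = t := by
  have := H.coord₀ s
  rw [hst, H.coord₀] at this
  exact (Real.sinh_injective this).symm

/-- The `h 2` coordinate would force `τ = 2e - τ'`. The `h 0` coordinate would then give `4 cosh² e
= 1`. -/
theorem reflection_smul_ne (H : IsFoldedAxis h η e) {τ τ' : ℝ} (h' : e < τ') :
    reflection339 2 • η τ' ≠ η τ := by
  intro heq
  have r₀ := (H.refl_two (η τ')).1
  have r₂ := (H.refl_two (η τ')).2.2
  rw [heq] at r₀ r₂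
  have c := H.coord₂ τ
  have c' := H.coord₂ τ'
  have hs : Real.sinh (e - τ) = Real.sinh (τ' - e) := by
    rw [← c, r₂, mul_neg, c', ← Real.sinh_neg]; ring_nf
  have hτ : τ = 2 * e - τ' := by
    have := Real.sinh_injective hs
    linarith
  rw [H.coord₀, H.coord₀] at r₀
  have hε : 0 < Real.sinh (τ' - e) := Real.sinh_pos_iff.2 (by linarith)
  have h1 : Real.sinh τ' - Real.sinh τ = 2 * Real.cosh e * Real.sinh (τ' - e) := by
    have key : ∀ u, Real.sinh (e + u) - Real.sinh (e - u) = 2 * Real.cosh e * Real.sinh u := by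
      intro u
      rw [Real.sinh_add, Real.sinh_sub]; ring
    rw [hτ, ← key]
    ring_nf
  have hc := Real.one_le_cosh e
  have h2 : 2 * Real.cosh e * (Real.sinh τ' - Real.sinh τ) = Real.sinh (τ' - e) := by
    rw [← hs, ← c, r₂]; rw [r₀]; ring
  rw [h1] at h2
  have h3 : 1 ≤ Real.cosh e * Real.cosh e := by nlinarith
  nlinarith [mul_le_mul_of_nonneg_right h3 hε.le]

/-- The translates of the half period `η '' [0, 2e]` of the axis under the triangle group meet it
only in the obvious way. -/
theorem rigid (H : IsFoldedAxis h η e) {τ τ' : ℝ} (h0 : 0 ≤ τ) (h1 : τ ≤ 2 * e) (h0' : 0 ≤ τ')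
    (h1' : τ' ≤ 2 * e) {w : Coxeter339} (hw : w • η τ = η τ') :
    τ = τ' ∧ (w = 1 ∨ (τ = 0 ∧ w = reflection339 0) ∨ (τ = e ∧ w = reflection339 2) ∨
      (τ = 2 * e ∧ w = reflection339 2 * reflection339 1 * reflection339 2)) := by
  have ss : reflection339 2 * reflection339 2 = 1 := relations339.1 2
  rcases le_or_gt τ e with hτ | hτ <;> rcases le_or_gt τ' e with hτ' | hτ'
  · obtain ⟨hfix, hc⟩ := H.eq_of_nonneg_of_le h0 hτ (w := w) (hw ▸ H.nonneg_of_le h0' hτ')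
    refine ⟨H.injective (hfix.symm.trans hw), ?_⟩
    tauto
  · exfalso
    have hw2 : (reflection339 2 * w) • η τ = reflection339 2 • η τ' := by rw [mul_smul, hw]
    obtain ⟨hfix, -⟩ := H.eq_of_nonneg_of_le h0 hτ (w := reflection339 2 * w)
      (hw2 ▸ H.nonneg_of_lt hτ' h1')
    exact H.reflection_smul_ne hτ' (hw2.symm.trans hfix)
  · exfalso
    have hw2 : (w * reflection339 2) • reflection339 2 • η τ = η τ' := by
      rw [smul_smul, mul_assoc, ss, mul_one, hw]
    obtain ⟨hfix, -⟩ := H.eq_of_nonneg_of_lt hτ h1 (w := w * reflection339 2)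
      (hw2 ▸ H.nonneg_of_le h0' hτ')
    exact H.reflection_smul_ne hτ (hfix.symm.trans hw2)
  · have hw2 : (reflection339 2 * w * reflection339 2) • reflection339 2 • η τ =
        reflection339 2 • η τ' := by
      rw [smul_smul, mul_assoc, ss, mul_one, mul_smul, hw]
    obtain ⟨hfix, hc⟩ := H.eq_of_nonneg_of_lt hτ h1 (w := reflection339 2 * w * reflection339 2)
      (hw2 ▸ H.nonneg_of_lt hτ' h1')
    refine ⟨H.injective (MulAction.injective _ (hfix.symm.trans hw2)), ?_⟩
    have hback : w = reflection339 2 * (reflection339 2 * w * reflection339 2) *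
        reflection339 2 := by
      simp only [mul_assoc, ss, mul_one]
      rw [← mul_assoc, ss, one_mul]
    rcases hc with hc | ⟨h2, hc⟩ <;> rw [hc] at hback
    · left; rw [hback, mul_one, ss]
    · right; right; right; exact ⟨h2, hback⟩

/-- Negative parameters are made nonnegative by `I₁`, which reverses the axis, and then rigidity
applies. Parity discards the odd candidates; at the ends of the half period the surviving ones are
`1` and `axial339 ^ (±1)`. -/
theorem even_crossing_aux (H : IsFoldedAxis h η e) {s t : ℝ} (hs : |s| ≤ 2 * e) (ht : |t| ≤ 2 * e)
    {g : Coxeter339} (hg : parity339 g = 1) (hgt : g • η t = η s) :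
    (∃ k : ℤ, g = axial339 ^ k ∧ s = t - 4 * e * k) ∨ (|t| = e ∧ |s| = e) := by
  have i₀ : (reflection339 0)⁻¹ = reflection339 0 := coxeterSystem339.inv_simple 0
  have odd : ∀ w : Coxeter339, parity339 w = 1 → ∀ i, w ≠ reflection339 i := by
    rintro _ h1 i rfl
    exact ofAdd_one_ne_one ((parity339_reflection i).symm.trans h1)
  have oddJ : ∀ w : Coxeter339, parity339 w = 1 →
      w ≠ reflection339 2 * reflection339 1 * reflection339 2 := by
    rintro _ h1 rfl
    simp only [map_mul, parity339_reflection, ofAdd_one_mul_self, one_mul] at h1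
    exact ofAdd_one_ne_one h1
  have evn : ∀ w : Coxeter339, parity339 w = Multiplicative.ofAdd 1 → w ≠ 1 := by
    rintro _ h1 rfl
    rw [map_one] at h1
    exact ofAdd_one_ne_one h1.symm
  rcases le_total 0 t with h0 | h0 <;> rcases le_total 0 s with h0' | h0'
  · rw [abs_of_nonneg h0] at ht ⊢
    rw [abs_of_nonneg h0'] at hs ⊢
    obtain ⟨rfl, hc⟩ := H.rigid h0 ht h0' hs hgt
    rcases hc with rfl | ⟨-, h2⟩ | ⟨h1, -⟩ | ⟨-, h2⟩
    · exact Or.inl ⟨0, by simp, by simp⟩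
    · exact absurd h2 (odd g hg 0)
    · exact Or.inr ⟨h1, h1⟩
    · exact absurd h2 (oddJ g hg)
  · rw [abs_of_nonneg h0] at ht ⊢
    rw [abs_of_nonpos h0'] at hs ⊢
    have hg' : parity339 (reflection339 0 * g) = Multiplicative.ofAdd 1 := by
      rw [map_mul, hg, parity339_reflection, mul_one]
    obtain ⟨h1, hc⟩ := H.rigid h0 ht (neg_nonneg.2 h0') hs (w := reflection339 0 * g)
      (by rw [mul_smul, hgt, H.reflection_zero_smul])
    rcases hc with h2 | ⟨h2, h3⟩ | ⟨h2, -⟩ | ⟨h2, h3⟩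
    · exact absurd h2 (evn _ hg')
    · rw [mul_eq_left] at h3
      exact Or.inl ⟨0, by simp [h3], by simp; linarith⟩
    · exact Or.inr ⟨h2, by linarith⟩
    · refine Or.inl ⟨1, ?_, by push_cast; linarith⟩
      rw [zpow_one, axial339, mul_assoc, mul_assoc, ← mul_assoc (reflection339 2), ← h3,
        ← mul_assoc, relations339.1 0, one_mul]
  · rw [abs_of_nonpos h0] at ht ⊢
    rw [abs_of_nonneg h0'] at hs ⊢
    have hg' : parity339 (g * reflection339 0) = Multiplicative.ofAdd 1 := by
      rw [map_mul, hg, parity339_reflection, one_mul]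
    obtain ⟨h1, hc⟩ := H.rigid (neg_nonneg.2 h0) ht h0' hs (w := g * reflection339 0)
      (by rw [mul_smul, H.reflection_zero_smul, neg_neg, hgt])
    rcases hc with h2 | ⟨h2, h3⟩ | ⟨h2, -⟩ | ⟨h2, h3⟩
    · exact absurd h2 (evn _ hg')
    · rw [mul_eq_right] at h3
      exact Or.inl ⟨0, by simp [h3], by simp; linarith⟩
    · exact Or.inr ⟨h2, by linarith⟩
    · refine Or.inl ⟨-1, ?_, by push_cast; linarith⟩
      have i₁ : (reflection339 1)⁻¹ = reflection339 1 := coxeterSystem339.inv_simple 1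
      have i₂ : (reflection339 2)⁻¹ = reflection339 2 := coxeterSystem339.inv_simple 2
      rw [zpow_neg_one, axial339]
      simp only [mul_inv_rev, i₀, i₁, i₂]
      rw [← mul_assoc, ← mul_assoc, ← h3, mul_assoc, relations339.1 0, mul_one]
  · rw [abs_of_nonpos h0] at ht ⊢
    rw [abs_of_nonpos h0'] at hs ⊢
    have hg' : parity339 (reflection339 0 * g * reflection339 0) = 1 := by
      rw [map_mul, map_mul, hg, parity339_reflection, mul_one, ofAdd_one_mul_self]
    obtain ⟨h1, hc⟩ := H.rigid (neg_nonneg.2 h0) ht (neg_nonneg.2 h0') hs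
      (w := reflection339 0 * g * reflection339 0)
      (by rw [mul_smul, mul_smul, H.reflection_zero_smul, neg_neg, hgt, H.reflection_zero_smul])
    rcases hc with h2 | ⟨-, h2⟩ | ⟨h2, -⟩ | ⟨-, h2⟩
    · refine Or.inl ⟨0, ?_, by simp; linarith⟩
      rw [zpow_zero]
      have := eq_inv_of_mul_eq_one_left h2
      rw [i₀, mul_eq_left] at this
      exact this
    · exact absurd h2 (odd _ hg' 0)
    · exact Or.inr ⟨h2, by linarith⟩
    · exact absurd h2 (oddJ _ hg')

theorem exists_abs_le (H : IsFoldedAxis h η e) (t : ℝ) :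
    ∃ k : ℤ, ∃ τ, |τ| ≤ 2 * e ∧ t = τ + 4 * e * k := by
  have hp := H.pos
  refine ⟨round (t / (4 * e)), t - 4 * e * round (t / (4 * e)), ?_, by ring⟩
  have h1 := abs_sub_round (t / (4 * e))
  have h2 : t - 4 * e * round (t / (4 * e)) = 4 * e * (t / (4 * e) - round (t / (4 * e))) := by
    field_simp
  rw [h2, abs_mul, abs_of_pos (by positivity)]
  nlinarith

/-- An orientation preserving element which maps a point of the axis to the axis is a translation
along the axis, unless both points are on the images of the side on `L₃`. -/
theorem even_crossing (H : IsFoldedAxis h η e) {s t : ℝ} {g : Coxeter339}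
    (hg : parity339 g = 1) (hgt : g • η t = η s) :
    (∃ k : ℤ, g = axial339 ^ k ∧ s = t - 4 * e * k) ∨
      ((∃ m : ℤ, t = e + 2 * e * m) ∧ ∃ m : ℤ, s = e + 2 * e * m) := by
  obtain ⟨a, τ, hτ, rfl⟩ := H.exists_abs_le t
  obtain ⟨b, σ, hσ, rfl⟩ := H.exists_abs_le s
  have hg' : parity339 (axial339 ^ b * g * axial339 ^ (-a)) = 1 := by
    rw [map_mul, map_mul, hg, map_zpow, map_zpow, parity339_axial]
    simp
  have key : ∀ (x : ℝ) (c : ℤ), |x| = e → ∃ m : ℤ, x + 4 * e * c = e + 2 * e * m := by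
    intro x c hx
    rcases (abs_eq H.pos.le).1 hx with rfl | rfl
    · exact ⟨2 * c, by push_cast; ring⟩
    · exact ⟨2 * c - 1, by push_cast; ring⟩
  rcases H.even_crossing_aux hσ hτ hg' (by
    rw [mul_smul, mul_smul, H.axial_zpow_smul]
    rw [show τ - 4 * e * (-a : ℤ) = τ + 4 * e * a by push_cast; ring, hgt, H.axial_zpow_smul,
      add_sub_cancel_right]) with ⟨k, h1, h2⟩ | ⟨h1, h2⟩
  · refine Or.inl ⟨k - b + a, ?_, ?_⟩
    · have : g = axial339 ^ (-b) * (axial339 ^ b * g * axial339 ^ (-a)) * axial339 ^ a := by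
        simp [mul_assoc]
      rw [this, h1, ← zpow_add, ← zpow_add]
      congr 1
      ring
    · rw [h2]; push_cast; ring
  · exact Or.inr ⟨key _ _ h1, key _ _ h2⟩

end IsFoldedAxis

/-! ## The closed geodesic -/

/-- The permutation of the cosets by `axial339`. -/
def axialPerm : Equiv.Perm (Fin 18) := cosetPerm₁ * cosetPerm₃ * cosetPerm₂ * cosetPerm₃

theorem cosetAction_axial : cosetAction axial339 = axialPerm := by
  simp only [axial339, map_mul, cosetAction_reflection]
  rfl

/-- The ninth power acts trivially on the triangles, and no smaller positive power fixes the first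
one. -/
theorem axial339_zpow_mem_iff (k : ℤ) : axial339 ^ k ∈ surfaceSubgroup339 ↔ 9 ∣ k := by
  have h9 : axialPerm ^ 9 = 1 := by
    set_option maxRecDepth 10000 in decide
  rw [mem_surfaceSubgroup339_iff, map_zpow, cosetAction_axial]
  obtain ⟨r, hr⟩ : ∃ r : ℕ, k % 9 = r := Int.eq_ofNat_of_zero_le (Int.emod_nonneg _ (by norm_num))
  have hr9 : r < 9 := by
    have := Int.emod_lt_of_pos k (show (0 : ℤ) < 9 by norm_num)
    omega
  have hk : axialPerm ^ k = axialPerm ^ r := by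
    rw [← Int.mul_ediv_add_emod k 9, hr, zpow_add, zpow_mul, show (9 : ℤ) = (9 : ℕ) from rfl,
      zpow_natCast, h9, one_zpow, one_mul, zpow_natCast]
  have key : ∀ r : Fin 9, (axialPerm ^ r.1) 0 = 0 → r = 0 := by decide
  rw [hk, Int.dvd_iff_emod_eq_zero, hr]
  constructor
  · intro h
    have := key ⟨r, hr9⟩ h
    simpa using congrArg Fin.val this
  · intro h
    have : r = 0 := by exact_mod_cast h
    subst this
    rfl

/-- The elements which map the midpoint `η e` of the triangle's base to the other midpoints of
bases on the axis. -/
noncomputable def crossingElement (m : ℕ) : Coxeter339 :=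
  if m % 2 = 0 then axial339 ^ (m / 2) * reflection339 0 else axial339 ^ ((m + 1) / 2)

/-- The triangles whose bases contain the midpoints on the axis, up to the surface subgroup. -/
def crossingCoset : Fin 18 → Fin 18 :=
  ![17, 8, 7, 10, 9, 12, 11, 2, 1, 4, 3, 6, 5, 14, 13, 16, 15, 0]

/-- This certifies the table: `crossingCoset m` is the preimage of `0`, that is, the right coset of
`crossingElement m`. -/
theorem cosetAction_crossingElement (m : Fin 18) :
    (cosetAction (crossingElement m)) (crossingCoset m) = 0 := by
  have key : ∀ m : Fin 18, (if m.1 % 2 = 0 then axialPerm ^ (m.1 / 2) * cosetPerm 0 else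
      axialPerm ^ ((m.1 + 1) / 2)) (crossingCoset m) = 0 := by
    set_option maxRecDepth 10000 in decide
  rw [← key m, crossingElement, apply_ite cosetAction, map_mul, map_pow, map_pow,
    cosetAction_axial, cosetAction_reflection]

/-- The table is injective and commutes with `cosetPerm₃`. Hence the permutation that pairs the
polygon's sides also pairs the crossing times. -/
theorem crossingCoset_iff (m n : Fin 18) :
    (crossingCoset n = crossingCoset m ∨ crossingCoset n = cosetPerm₃ (crossingCoset m)) ↔
      n = m ∨ n = cosetPerm₃ m := by
  revert m n
  decide

theorem cosetPerm₃_ne (m : Fin 18) : cosetPerm₃ m ≠ m := by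
  revert m
  decide

theorem cosetPerm₃_cosetPerm₃ (m : Fin 18) : cosetPerm₃ (cosetPerm₃ m) = m := by
  revert m
  decide

namespace IsFoldedAxis

variable {X Y : Type*} [MulAction Coxeter339 X] {h : Fin 3 → X → ℝ} {η : ℝ → X} {e : ℝ}

theorem crossingElement_smul (H : IsFoldedAxis h η e) (m : ℕ) :
    crossingElement m • η e = η (-(e + 2 * e * m)) := by
  rw [crossingElement]
  split_ifs with hm
  · obtain ⟨k, rfl⟩ : ∃ k, m = 2 * k := ⟨m / 2, by omega⟩
    rw [show 2 * k / 2 = k by omega, mul_smul, H.reflection_zero_smul, ← zpow_natCast,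
      H.axial_zpow_smul]
    push_cast
    ring_nf
  · obtain ⟨k, rfl⟩ : ∃ k, m = 2 * k + 1 := ⟨m / 2, by omega⟩
    rw [show (2 * k + 1 + 1) / 2 = k + 1 by omega, ← zpow_natCast, H.axial_zpow_smul]
    push_cast
    ring_nf

/-- By rigidity the stabilizer of `η e` is `{1, I₃}`. So an element taking the `n`-th midpoint to
the `m`-th is `u v⁻¹` or `u I₃ v⁻¹`, and membership in `Γ` is an equality of cosets. -/
theorem exists_smul_crossing_iff (H : IsFoldedAxis h η e) (m n : Fin 18) :
    (∃ g ∈ surfaceSubgroup339, g • η (-(e + 2 * e * n.1)) = η (-(e + 2 * e * m.1))) ↔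
      n = m ∨ n = cosetPerm₃ m := by
  have hp := H.pos
  rw [← crossingCoset_iff, ← H.crossingElement_smul, ← H.crossingElement_smul]
  have hm := cosetAction_crossingElement m
  have hn := cosetAction_crossingElement n
  set u := crossingElement m
  set v := crossingElement n
  have i₂ : (reflection339 2)⁻¹ = reflection339 2 := coxeterSystem339.inv_simple 2
  have hm' : (cosetAction u)⁻¹ 0 = crossingCoset m := by rw [Equiv.Perm.inv_eq_iff_eq, hm]
  have hinj : ∀ j, cosetAction v j = 0 ↔ crossingCoset n = j := by
    intro j
    rw [← hn, EmbeddingLike.apply_eq_iff_eq, eq_comm]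
  have m₁ : u * v⁻¹ ∈ surfaceSubgroup339 ↔ crossingCoset n = crossingCoset m := by
    rw [← inv_mem_iff, mem_surfaceSubgroup339_iff, mul_inv_rev, inv_inv, map_mul, map_inv,
      Equiv.Perm.mul_apply, hm', hinj]
  have m₂ : u * reflection339 2 * v⁻¹ ∈ surfaceSubgroup339 ↔
      crossingCoset n = cosetPerm₃ (crossingCoset m) := by
    rw [← inv_mem_iff, mem_surfaceSubgroup339_iff, mul_inv_rev, mul_inv_rev, inv_inv, i₂, map_mul,
      map_mul, map_inv, cosetAction_reflection, Equiv.Perm.mul_apply, Equiv.Perm.mul_apply, hm',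
      hinj]
    rfl
  rw [← m₁, ← m₂]
  constructor
  · rintro ⟨g, hg, hgt⟩
    have hfix : (u⁻¹ * g * v) • η e = η e := by
      rw [mul_smul, mul_smul, hgt, inv_smul_smul]
    obtain ⟨-, hc⟩ := H.rigid hp.le (by linarith) hp.le (by linarith) hfix
    have hb : g = u * (u⁻¹ * g * v) * v⁻¹ := by simp [mul_assoc]
    rcases hc with hc | ⟨h0, -⟩ | ⟨-, hc⟩ | ⟨h0, -⟩
    · rw [hc, mul_one] at hb
      exact Or.inl (hb ▸ hg)
    · linarith
    · rw [hc] at hb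
      exact Or.inr (hb ▸ hg)
    · linarith
  · rintro (hg | hg)
    · exact ⟨_, hg, by rw [mul_smul, inv_smul_smul]⟩
    · exact ⟨_, hg, by rw [mul_smul, inv_smul_smul, mul_smul, H.reflection_two_smul]⟩

/-! ### Self-intersections of the projected axis -/

variable {c : ℝ → Y}

/-- A power of `f` in `Γ` shifts the parameter by a multiple of the whole period, so it cannot
identify distinct times in one period. Only the base midpoints remain. -/
theorem exists_eq_crossing (H : IsFoldedAxis h η e)
    (hc : ∀ s t, c s = c t ↔ ∃ g ∈ surfaceSubgroup339, g • η (-t) = η (-s)) {s t : ℝ}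
    (hs : s ∈ Set.Ico 0 (9 * (4 * e))) (ht : t ∈ Set.Ico 0 (9 * (4 * e))) (hst : s ≠ t)
    (h : c s = c t) : ∃ m : Fin 18, s = e + 2 * e * m.1 := by
  obtain ⟨g, hg, hgt⟩ := (hc s t).1 h
  rcases H.even_crossing (parity339_eq_one_of_mem hg) hgt with ⟨k, rfl, hk⟩ | ⟨-, m, hm⟩
  · exfalso
    obtain ⟨l, rfl⟩ := (axial339_zpow_mem_iff k).1 hg
    obtain ⟨hs0, hs1⟩ := hs
    obtain ⟨ht0, ht1⟩ := ht
    push_cast at hk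
    have l1 : (l : ℝ) < 1 := by
      by_contra! hl
      nlinarith
    have l2 : (-1 : ℝ) < l := by
      by_contra! hl
      nlinarith
    have l1' : l < 1 := by exact_mod_cast l1
    have l2' : -1 < l := by exact_mod_cast l2
    obtain rfl : l = 0 := by omega
    apply hst
    push_cast at hk
    linarith
  · obtain ⟨hs0, hs1⟩ := hs
    have l1 : (-m - 1 : ℝ) < 18 := by
      by_contra! hl
      nlinarith
    have l2 : (-1 : ℝ) < -m - 1 := by
      by_contra! hl
      nlinarith
    have l1' : -m - 1 < 18 := by exact_mod_cast l1
    have l2' : -1 < -m - 1 := by exact_mod_cast l2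
    -- The curve runs along `η` backwards: `-s = e + 2em` means `s = e + 2e(-m - 1)`.
    obtain ⟨n, hn⟩ := Int.eq_ofNat_of_zero_le (show 0 ≤ -m - 1 by omega)
    refine ⟨⟨n, by omega⟩, ?_⟩
    have : (n : ℝ) = -m - 1 := by exact_mod_cast hn.symm
    change s = e + 2 * e * (n : ℝ)
    rw [this]
    linarith

theorem crossing_mem (H : IsFoldedAxis h η e) (m : Fin 18) :
    e + 2 * e * m.1 ∈ Set.Ico 0 (9 * (4 * e)) := by
  have hp := H.pos
  have h1 : (m.1 : ℝ) ≤ 17 := by exact_mod_cast Nat.le_of_lt_succ m.2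
  constructor <;> nlinarith

theorem crossing_injective (H : IsFoldedAxis h η e) :
    Function.Injective fun m : Fin 18 => e + 2 * e * (m.1 : ℝ) := by
  intro m n hmn
  have hp := H.pos
  have : (m.1 : ℝ) = n.1 := by
    apply mul_left_cancel₀ (show 2 * e ≠ 0 by positivity)
    simpa using hmn
  exact Fin.ext (by exact_mod_cast this)

theorem crossing_eq_iff (H : IsFoldedAxis h η e)
    (hc : ∀ s t, c s = c t ↔ ∃ g ∈ surfaceSubgroup339, g • η (-t) = η (-s)) (m n : Fin 18) :
    c (e + 2 * e * m.1) = c (e + 2 * e * n.1) ↔ n = m ∨ n = cosetPerm₃ m := by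
  rw [hc, H.exists_smul_crossing_iff]

theorem passages_crossing {Y : Type} {c : ℝ → Y} (H : IsFoldedAxis h η e)
    (hc : ∀ s t, c s = c t ↔ ∃ g ∈ surfaceSubgroup339, g • η (-t) = η (-s)) (m : Fin 18) :
    passages c (9 * (4 * e)) (c (e + 2 * e * m.1)) =
      {e + 2 * e * m.1, e + 2 * e * (cosetPerm₃ m).1} := by
  ext t
  constructor
  · rintro ⟨ht, hct⟩
    by_cases htm : t = e + 2 * e * m.1
    · exact Or.inl htm
    obtain ⟨n, rfl⟩ := H.exists_eq_crossing hc ht (H.crossing_mem m) htm hct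
    rcases (H.crossing_eq_iff hc m n).1 hct.symm with rfl | rfl
    · exact Or.inl rfl
    · exact Or.inr rfl
  · rintro (rfl | rfl)
    · exact ⟨H.crossing_mem m, rfl⟩
    · exact ⟨H.crossing_mem _, ((H.crossing_eq_iff hc m _).2 (Or.inr rfl)).symm⟩

theorem ncard_passages_crossing {Y : Type} {c : ℝ → Y} (H : IsFoldedAxis h η e)
    (hc : ∀ s t, c s = c t ↔ ∃ g ∈ surfaceSubgroup339, g • η (-t) = η (-s)) (m : Fin 18) :
    (passages c (9 * (4 * e)) (c (e + 2 * e * m.1))).ncard = 2 := by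
  rw [H.passages_crossing hc, Set.ncard_pair]
  exact fun h => cosetPerm₃_ne m (H.crossing_injective h).symm

theorem selfIntersectionPoints_eq {Y : Type} {c : ℝ → Y} (H : IsFoldedAxis h η e)
    (hc : ∀ s t, c s = c t ↔ ∃ g ∈ surfaceSubgroup339, g • η (-t) = η (-s)) :
    selfIntersectionPoints c (9 * (4 * e)) =
      Set.range fun m : Fin 18 => c (e + 2 * e * m.1) := by
  ext x
  constructor
  · rintro ⟨s, ⟨hs, hsx⟩, t, ⟨ht, htx⟩, hst⟩
    obtain ⟨m, rfl⟩ := H.exists_eq_crossing hc hs ht hst (hsx.trans htx.symm)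
    exact ⟨m, hsx⟩
  · rintro ⟨m, rfl⟩
    refine ⟨e + 2 * e * m.1, ?_, e + 2 * e * (cosetPerm₃ m).1, ?_, ?_⟩
    · change _ ∈ passages c (9 * (4 * e)) (c (e + 2 * e * m.1))
      rw [H.passages_crossing hc]; exact Or.inl rfl
    · change _ ∈ passages c (9 * (4 * e)) (c (e + 2 * e * m.1))
      rw [H.passages_crossing hc]; exact Or.inr rfl
    · exact fun h => cosetPerm₃_ne m (H.crossing_injective h).symm

theorem ncard_selfIntersectionPoints {Y : Type} {c : ℝ → Y} (H : IsFoldedAxis h η e)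
    (hc : ∀ s t, c s = c t ↔ ∃ g ∈ surfaceSubgroup339, g • η (-t) = η (-s)) :
    (selfIntersectionPoints c (9 * (4 * e))).ncard = 9 := by
  -- Each double point is represented by the earlier of its two passages.
  have himg : selfIntersectionPoints c (9 * (4 * e)) =
      (fun m : Fin 18 => c (e + 2 * e * m.1)) ''
        ((Finset.univ.filter fun m => m < cosetPerm₃ m : Finset (Fin 18)) : Set (Fin 18)) := by
    rw [H.selfIntersectionPoints_eq hc]
    ext x
    constructor
    · rintro ⟨m, rfl⟩
      rcases (cosetPerm₃_ne m).lt_or_gt with hm | hm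
      · refine ⟨cosetPerm₃ m, ?_, ((H.crossing_eq_iff hc m _).2 (Or.inr rfl)).symm⟩
        simp [cosetPerm₃_cosetPerm₃, hm]
      · exact ⟨m, by simpa using hm, rfl⟩
    · rintro ⟨m, -, rfl⟩
      exact ⟨m, rfl⟩
  rw [himg, Set.InjOn.ncard_image, Set.ncard_coe_finset]
  · decide
  · intro m hm n hn hmn
    rcases (H.crossing_eq_iff hc m n).1 hmn with h1 | h1
    · exact h1.symm
    · exfalso
      have hm' : m < cosetPerm₃ m := by simpa using hm
      have hn' : n < cosetPerm₃ n := by simpa using hn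
      rw [h1, cosetPerm₃_cosetPerm₃] at hn'
      exact absurd hm' hn'.le.not_gt

theorem periodic_projection (H : IsFoldedAxis h η e)
    (hc : ∀ s t, c s = c t ↔ ∃ g ∈ surfaceSubgroup339, g • η (-t) = η (-s)) :
    Function.Periodic c (9 * (4 * e)) := by
  intro t
  rw [hc]
  refine ⟨axial339 ^ (9 : ℤ), (axial339_zpow_mem_iff 9).2 (dvd_refl 9), ?_⟩
  rw [H.axial_zpow_smul]
  push_cast
  ring_nf

theorem not_isSimpleClosedCurve {Y : Type} {c : ℝ → Y} (H : IsFoldedAxis h η e)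
    (hc : ∀ s t, c s = c t ↔ ∃ g ∈ surfaceSubgroup339, g • η (-t) = η (-s)) :
    ¬ IsSimpleClosedCurve c (9 * (4 * e)) := by
  intro hsimple
  have := hsimple (H.crossing_mem 0) (H.crossing_mem (cosetPerm₃ 0))
    ((H.crossing_eq_iff hc 0 _).2 (Or.inr rfl))
  exact cosetPerm₃_ne 0 (H.crossing_injective this).symm

end IsFoldedAxis

/-! ## The triangle group of isometries -/

section Isometries

variable {I₁ I₂ I₃ : ℍ ≃ᵢ ℍ} {h : Fin 3 → ℍ → ℝ}

/-- Isometries that agree in the coordinates `h` are equal, so each Coxeter relation is a matrix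
identity. The only arithmetic input is the cubic equation `l³ = 3l + 1` of `l = 2 cos (π/9)`. -/
theorem isLiftable_of_coordinates (ext : ∀ z w, (∀ i, h i z = h i w) → z = w)
    (hI : ∀ i j z, h i ((![I₁, I₂, I₃] : Fin 3 → (ℍ ≃ᵢ ℍ)) j z) =
        h i z + 2 * Real.cos (Real.pi / coxeterMatrix339 i j) * h j z) :
    coxeterMatrix339.IsLiftable (![I₁, I₂, I₃] : Fin 3 → (ℍ ≃ᵢ ℍ)) := by
  set l := 2 * Real.cos (Real.pi / 9) with hl
  have hl3 : l ^ 3 = 3 * l + 1 := by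
    have := four_mul_cos_pi_div_nine_cube
    rw [hl]; linear_combination this
  have a₀ : ∀ z, h 0 (I₁ z) = -h 0 z := fun z => by
    have := hI 0 0 z
    simp [coxeterMatrix339] at this
    linarith
  have a₁ : ∀ z, h 1 (I₁ z) = h 1 z + l * h 0 z := fun z => hI 1 0 z
  have a₂ : ∀ z, h 2 (I₁ z) = h 2 z + h 0 z := fun z => by
    have := hI 2 0 z
    simpa [coxeterMatrix339] using this
  have b₀ : ∀ z, h 0 (I₂ z) = h 0 z + l * h 1 z := fun z => hI 0 1 z
  have b₁ : ∀ z, h 1 (I₂ z) = -h 1 z := fun z => by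
    have := hI 1 1 z
    simp [coxeterMatrix339] at this
    linarith
  have b₂ : ∀ z, h 2 (I₂ z) = h 2 z + h 1 z := fun z => by
    have := hI 2 1 z
    simpa [coxeterMatrix339] using this
  have c₀ : ∀ z, h 0 (I₃ z) = h 0 z + h 2 z := fun z => by
    have := hI 0 2 z
    simpa [coxeterMatrix339] using this
  have c₁ : ∀ z, h 1 (I₃ z) = h 1 z + h 2 z := fun z => by
    have := hI 1 2 z
    simpa [coxeterMatrix339] using this
  have c₂ : ∀ z, h 2 (I₃ z) = -h 2 z := fun z => by
    have := hI 2 2 z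
    simp [coxeterMatrix339] at this
    linarith
  have E : ∀ g : ℍ ≃ᵢ ℍ, (∀ z, h 0 (g z) = h 0 z) → (∀ z, h 1 (g z) = h 1 z) →
      (∀ z, h 2 (g z) = h 2 z) → g = 1 := by
    intro g h0 h1 h2
    refine IsometryEquiv.ext fun z => ext _ _ fun i => ?_
    fin_cases i
    exacts [h0 z, h1 z, h2 z]
  refine isLiftable339 ?_ ?_ ?_ ?_
  · intro i
    fin_cases i
    · change I₁ * I₁ = 1
      apply E <;> intro z <;> simp [IsometryEquiv.mul_apply, a₀, a₁, a₂]
    · change I₂ * I₂ = 1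
      apply E <;> intro z <;> simp [IsometryEquiv.mul_apply, b₀, b₁, b₂]
    · change I₃ * I₃ = 1
      apply E <;> intro z <;> simp [IsometryEquiv.mul_apply, c₀, c₁, c₂]
  · change (I₁ * I₂) ^ 9 = 1
    -- The ninth power is computed as the cube of a cube, reducing the entries modulo the cubic in
    -- between to keep degrees small.
    have T0 : ∀ z, h 0 (((I₁ * I₂) ^ 3) z) =
        (-1 - l) * h 0 z + (1 - l ^ 2) * h 1 z := by
      intro z
      simp only [pow_succ, pow_zero, one_mul, IsometryEquiv.mul_apply, a₀, a₁, b₀, b₁]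
      linear_combination (((-1) * l ^ 1) * h 0 z + ((1)  + (-1) * l ^ 2) * h 1 z) * hl3
    have T1 : ∀ z, h 1 (((I₁ * I₂) ^ 3) z) =
        (l ^ 2 - 1) * h 0 z + l * h 1 z := by
      intro z
      simp only [pow_succ, pow_zero, one_mul, IsometryEquiv.mul_apply, a₀, a₁, b₀, b₁]
      linear_combination
        ((-1 + l ^ 2) * h 0 z + (1 + (-2) * l + l ^ 3) * h 1 z) * hl3
    have T2 : ∀ z, h 2 (((I₁ * I₂) ^ 3) z) =
        (2 + 3 * l + l ^ 2) * h 0 z + (1 + 3 * l + 2 * l ^ 2) * h 1 z + h 2 z := by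
      intro z
      simp only [pow_succ, pow_zero, one_mul, IsometryEquiv.mul_apply, a₀, a₁, a₂, b₀, b₁, b₂]
      linear_combination (((1)  + (1) * l ^ 1) * h 0 z + ((1) * l ^ 1 + (1) * l ^ 2) * h 1 z) * hl3
    rw [show 9 = 3 * 3 from rfl, pow_mul]
    generalize (I₁ * I₂) ^ 3 = T at T0 T1 T2
    apply E <;> intro z <;>
      simp only [pow_succ, pow_zero, one_mul, IsometryEquiv.mul_apply, T0, T1, T2]
    · linear_combination
        (((2) * l + l ^ 2) * h 0 z + ((-1) * l + l ^ 3) * h 1 z) * hl3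
    · linear_combination
        ((l + (-1) * l ^ 3) * h 0 z + (l + (-1) * l ^ 2) * h 1 z) * hl3
    · linear_combination
        (((-2) * l + (-3) * l ^ 2 + (-1) * l ^ 3) * h 0 z + ((-1) * l + (-3) * l ^ 2 + (-2) * l ^ 3) * h 1 z) * hl3
  · change (I₁ * I₃) ^ 3 = 1
    apply E <;> intro z <;>
      simp only [pow_succ, pow_zero, one_mul, IsometryEquiv.mul_apply, a₀, a₁, a₂, c₀, c₁, c₂] <;>
      ring
  · change (I₂ * I₃) ^ 3 = 1
    apply E <;> intro z <;>
      simp only [pow_succ, pow_zero, one_mul, IsometryEquiv.mul_apply, b₀, b₁, b₂, c₀, c₁, c₂] <;>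
      ring

end Isometries

theorem map_polygonElement {G H : Type*} [Group G] [Group H] (φ : G →* H) (a b : G) (j : ℤ) :
    φ (polygonElement a b j) = polygonElement (φ a) (φ b) j := by
  rw [polygonElement, polygonElement, apply_ite φ, map_mul, map_zpow, map_zpow, map_mul]

theorem map_pairingElement {G H : Type*} [Group G] [Group H] (φ : G →* H) (a b c : G) (k : Fin 9) :
    φ (pairingElement a b c k) = pairingElement (φ a) (φ b) (φ c) k := by
  rw [pairingElement, pairingElement, map_mul, map_mul, map_inv, map_polygonElement,
    map_polygonElement]

section TriangleHom

variable {I₁ I₂ I₃ : ℍ ≃ᵢ ℍ} {φ : Coxeter339 →* (ℍ ≃ᵢ ℍ)}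

theorem map_pairingElement339 (h₁ : φ (reflection339 0) = I₁)
    (h₂ : φ (reflection339 1) = I₂) (h₃ : φ (reflection339 2) = I₃) (k : Fin 9) :
    φ (pairingElement339 k) = pairingElement I₁ I₂ I₃ k := by
  rw [pairingElement339, map_pairingElement, h₁, h₂, h₃]

theorem sidePairing_eq_map (h₁ : φ (reflection339 0) = I₁)
    (h₂ : φ (reflection339 1) = I₂) (h₃ : φ (reflection339 2) = I₃) (k : Fin 9) :
    sidePairing I₁ I₂ I₃ k = φ (pairingElement339 k) := by
  rw [map_pairingElement339 h₁ h₂ h₃]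
  apply sidePairing_eq_pairingElement
  · rw [← h₁, ← map_mul, relations339.1, map_one]
  · rw [← h₂, ← map_mul, relations339.1, map_one]
  · rw [← h₁, ← h₂, ← map_mul, ← map_pow, relations339.2.2.1, map_one]

theorem surfaceSubgroup_eq_map (h₁ : φ (reflection339 0) = I₁)
    (h₂ : φ (reflection339 1) = I₂) (h₃ : φ (reflection339 2) = I₃) :
    surfaceSubgroup I₁ I₂ I₃ = surfaceSubgroup339.map φ := by
  rw [surfaceSubgroup, surfaceSubgroup339, MonoidHom.map_closure, ← Set.range_comp]
  congr 2
  exact funext (sidePairing_eq_map h₁ h₂ h₃)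

theorem triangleGroup_eq_map (h₁ : φ (reflection339 0) = I₁)
    (h₂ : φ (reflection339 1) = I₂) (h₃ : φ (reflection339 2) = I₃) :
    triangleGroup I₁ I₂ I₃ = (⊤ : Subgroup Coxeter339).map φ := by
  rw [triangleGroup, ← coxeterSystem339.subgroup_closure_range_simple, MonoidHom.map_closure,
    ← Set.range_comp]
  congr 1
  ext g
  simp only [Set.mem_insert_iff, Set.mem_singleton_iff, Set.mem_range, Fin.exists_fin_succ,
    Function.comp_apply, ← h₁, ← h₂, ← h₃, IsEmpty.exists_iff, or_false, eq_comm (a := g)]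
  rfl

end TriangleHom

/-- The point `η (e/2)` is interior to the chamber, so its stabilizer is trivial; this makes the
action faithful. -/
theorem IsFoldedAxis.eq_one {X : Type*} [MulAction Coxeter339 X] {h : Fin 3 → X → ℝ} {η : ℝ → X}
    {e : ℝ} (H : IsFoldedAxis h η e) {w : Coxeter339} (hw : w • η (e / 2) = η (e / 2)) : w = 1 := by
  have hp := H.pos
  have hx : ∀ i, 0 < h i (η (e / 2)) := by
    intro i
    fin_cases i
    · exact (H.coord₀ _).symm ▸ Real.sinh_pos_iff.2 (by linarith)
    · exact H.coord_one_pos (by linarith)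
    · exact H.coord_two_pos_iff.2 (by linarith)
  exact H.root.eq_one coxeterMatrix339_ne_zero hx fun i => hw.symm ▸ (hx i).le

/-- The triangle group of isometries is the abstract one, acting with an axis of `axial339`. -/
theorem exists_triangleHom {L₁ L₂ L₃ : Set ℍ} {I₁ I₂ I₃ : ℍ ≃ᵢ ℍ}
    (h₂₃ : MeetAtAngle L₂ L₃ (Real.pi / 3)) (h₁₃ : MeetAtAngle L₁ L₃ (Real.pi / 3))
    (h₁₂ : MeetAtAngle L₁ L₂ (Real.pi / 9)) (hI₁ : IsInversionIn I₁ L₁)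
    (hI₂ : IsInversionIn I₂ L₂) (hI₃ : IsInversionIn I₃ L₃) :
    ∃ φ : Coxeter339 →* (ℍ ≃ᵢ ℍ), Function.Injective φ ∧ φ (reflection339 0) = I₁ ∧
      φ (reflection339 1) = I₂ ∧ φ (reflection339 2) = I₃ ∧
      ∃ (h : Fin 3 → ℍ → ℝ) (η : ℝ → ℍ) (e : ℝ), Isometry η ∧
        letI : MulAction Coxeter339 ℍ := MulAction.compHom ℍ φ
        IsFoldedAxis h η e := by
  obtain ⟨h, η, e, ext, hI, hp, hch, hη, c₀, c₁, c₂⟩ :=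
    exists_triangle_coordinates h₂₃ h₁₃ h₁₂ hI₁ hI₂ hI₃
  have hL := isLiftable_of_coordinates ext hI
  set φ : Coxeter339 →* (ℍ ≃ᵢ ℍ) := coxeterSystem339.lift ⟨_, hL⟩
  have hφ : ∀ i, φ (reflection339 i) = (![I₁, I₂, I₃] : Fin 3 → (ℍ ≃ᵢ ℍ)) i :=
    coxeterSystem339.lift_apply_simple hL
  let _ : MulAction Coxeter339 ℍ := MulAction.compHom ℍ φ
  have H : IsFoldedAxis h η e :=
    { root := fun i j z => by rw [← hI i j z, ← hφ j]; rfl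
      ext, pos := hp, cosh_two_mul := hch, coord₀ := c₀, coord₁ := c₁, coord₂ := c₂ }
  refine ⟨φ, (injective_iff_map_eq_one φ).2 fun w hw => H.eq_one ?_, hφ 0, hφ 1, hφ 2, h, η, e, hη,
    H⟩
  change (φ w) (η (e / 2)) = η (e / 2)
  rw [hw]
  rfl

theorem projectedCurve_map_eq_iff {G : Type*} [Group G] (φ : G →* (ℍ ≃ᵢ ℍ)) (Γ : Subgroup G)
    (γ : ℝ → ℍ) (s t : ℝ) : projectedCurve (Γ.map φ) γ s = projectedCurve (Γ.map φ) γ t ↔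
      ∃ g ∈ Γ, φ g (γ t) = γ s := by
  refine Quotient.eq.trans ?_
  constructor
  · rintro ⟨⟨_, g, hg, rfl⟩, h⟩
    exact ⟨g, hg, h⟩
  · rintro ⟨g, hg, h⟩
    exact ⟨⟨φ g, g, hg, rfl⟩, h⟩

/-! ### Transfer of the results to the group of isometries -/

theorem propositionH2
    (L₁ L₂ L₃ : Set ℍ) (I₁ I₂ I₃ : ℍ ≃ᵢ ℍ) (A₁ A₂ : ℍ)
    (h₂₃ : MeetAtAngle L₂ L₃ (Real.pi / 3))
    (h₁₃ : MeetAtAngle L₁ L₃ (Real.pi / 3))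
    (h₁₂ : MeetAtAngle L₁ L₂ (Real.pi / 9))
    (hI₁ : IsInversionIn I₁ L₁) (hI₂ : IsInversionIn I₂ L₂) (hI₃ : IsInversionIn I₃ L₃)
    (hA₁ : A₁ ∈ L₁ ∩ L₃) (hA₂ : A₂ ∈ L₂ ∩ L₃) :
    -- the generators of `Γ` pair the sides of the 18-gon
    (∀ k : Fin 9, sidePairing I₁ I₂ I₃ k '' polygonSide I₁ I₂ A₁ A₂ (sourceSide k) =
      polygonSide I₁ I₂ A₁ A₂ (targetSide k)) ∧
    -- `Γ` is a genus 2 surface subgroup of the triangle group, of index 18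
    surfaceSubgroup I₁ I₂ I₃ ≤ triangleGroup I₁ I₂ I₃ ∧
    (surfaceSubgroup I₁ I₂ I₃).relIndex (triangleGroup I₁ I₂ I₃) = 18 ∧
    Nonempty (surfaceSubgroup I₁ I₂ I₃ ≃* SurfaceGroup 2) ∧
    -- `f = I₁I₃I₂I₃` is hyperbolic, with axis `γ` and translation length `ℓ`, and `f ^ n` is its
    -- first power in `Γ`; the axis projects to a closed geodesic of length `n * ℓ`
    ∃ (γ : ℝ → ℍ) (ℓ : ℝ) (n : ℕ),
      IsAxis (I₁ * I₃ * I₂ * I₃) γ ℓ ∧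
      IsLeast {m : ℕ | 0 < m ∧ (I₁ * I₃ * I₂ * I₃) ^ m ∈ surfaceSubgroup I₁ I₂ I₃} n ∧
      Function.Periodic (projectedCurve (surfaceSubgroup I₁ I₂ I₃) γ) (n * ℓ) ∧
      -- this closed geodesic is not simple: it has exactly 9 self-intersection points, which
      -- are all double points
      ¬ IsSimpleClosedCurve (projectedCurve (surfaceSubgroup I₁ I₂ I₃) γ) (n * ℓ) ∧
      (selfIntersectionPoints (projectedCurve (surfaceSubgroup I₁ I₂ I₃) γ) (n * ℓ)).ncard = 9 ∧
      ∀ x ∈ selfIntersectionPoints (projectedCurve (surfaceSubgroup I₁ I₂ I₃) γ) (n * ℓ),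
        (passages (projectedCurve (surfaceSubgroup I₁ I₂ I₃) γ) (n * ℓ) x).ncard = 2 := by
  obtain ⟨φ, hφ, hφ₁, hφ₂, hφ₃, h, η, e, hη, H⟩ := exists_triangleHom h₂₃ h₁₃ h₁₂ hI₁ hI₂ hI₃
  let _ : MulAction Coxeter339 ℍ := MulAction.compHom ℍ φ
  have hp := H.pos
  have fix : ∀ {I : ℍ ≃ᵢ ℍ} {L : Set ℍ} {z : ℍ}, IsInversionIn I L → z ∈ L → I z = z := by
    rintro I _ z rfl hz
    exact hz
  have hf : I₁ * I₃ * I₂ * I₃ = φ axial339 := by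
    rw [axial339, map_mul, map_mul, map_mul, hφ₁, hφ₂, hφ₃]
  have hΓ := surfaceSubgroup_eq_map hφ₁ hφ₂ hφ₃
  have hc : ∀ s t, projectedCurve (surfaceSubgroup I₁ I₂ I₃) (fun t => η (-t)) s =
      projectedCurve (surfaceSubgroup I₁ I₂ I₃) (fun t => η (-t)) t ↔
      ∃ g ∈ surfaceSubgroup339, φ g (η (-t)) = η (-s) := by
    rw [hΓ]
    exact projectedCurve_map_eq_iff φ surfaceSubgroup339 _
  -- The parametrization is reversed because `f` translates `η` by `-4e`.
  refine ⟨fun k => ?_, ?_, ?_, ?_, fun t => η (-t), 4 * e, 9, ⟨?_, by positivity, fun t => ?_⟩,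
    ⟨⟨by norm_num, ?_⟩, ?_⟩, ?_⟩
  · rw [sidePairing_eq_map hφ₁ hφ₂ hφ₃, map_pairingElement339 hφ₁ hφ₂ hφ₃]
    exact pairingElement_image_polygonSide (fix hI₁ hA₁.1) (fix hI₂ hA₂.1) (fix hI₃ hA₁.2)
      (fix hI₃ hA₂.2) k
  · rw [hΓ, triangleGroup_eq_map hφ₁ hφ₂ hφ₃]
    exact Subgroup.map_mono le_top
  · rw [hΓ, triangleGroup_eq_map hφ₁ hφ₂ hφ₃, Subgroup.relIndex_map_map_of_injective _ _ hφ,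
      Subgroup.relIndex_top_right, surfaceSubgroup339_index]
  · rw [hΓ]
    obtain ⟨ψ⟩ := nonempty_surfaceSubgroup339_mulEquiv
    exact ⟨(surfaceSubgroup339.equivMapOfInjective φ hφ).symm.trans ψ⟩
  · exact hη.comp (IsometryEquiv.neg ℝ).isometry
  · rw [hf, neg_add']
    exact H.axial_smul (-t)
  · rw [hf, hΓ, ← map_pow, Subgroup.mem_map_iff_mem hφ, ← zpow_natCast, axial339_zpow_mem_iff]
    norm_num
  · rintro m ⟨hm, hmΓ⟩
    rw [hf, hΓ, ← map_pow, Subgroup.mem_map_iff_mem hφ, ← zpow_natCast,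
      axial339_zpow_mem_iff] at hmΓ
    omega
  · rw [show ((9 : ℕ) : ℝ) = 9 by norm_num]
    refine ⟨H.periodic_projection hc, H.not_isSimpleClosedCurve hc,
      H.ncard_selfIntersectionPoints hc, ?_⟩
    rw [H.selfIntersectionPoints_eq hc]
    rintro _ ⟨m, rfl⟩
    exact H.ncard_passages_crossing hc m
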